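/- **Theorem (unisolvence for $P_k^*(K;\mathbb S)$, $k>2$).** Let $n\ge 1$, let $k>2$, let $K\subset\mathbb R^n$ be a nondegenerate $n$-simplex, and let $\mathbb S$ be the space of symmetric $n\times n$ real matrices. Let $P_m(F;X)$ denote the $X$-valued polynomial functions of degree at most $m$ on $F$ (and $P_m(F)=P_m(F;\mathbb R)$), let $\operatorname{div}$ act row-wise, let $\epsilon(v)=\tfrac12(\nabla v+\nabla v^T)$, and put $$P_k^*(K;\mathbb S)=P_k(K;\mathbb S)+\{\tau:\ \tau \text{ an } \mathbb S\text{-valued polynomial with terms of degrees } k+1,\dots,k+n-1 \text{ only},\ \operatorname{div}\tau=0\},$$ $$M_k(K)=\{\tau\in P_k^*(K;\mathbb S):\ \operatorname{div}\tau=0,\ \tau\nu=0 \text{ on } \partial K\},$$ where $\nu$ is the normal of $\partial K$. For each $\ell$-dimensional subsimplex $\triangle_\ell$ of $K$, $0\le\ell\le n-1$, fix $\ell$ linearly independent tangential vectors $t_1,\dots,t_\ell$ and $n-\ell$ linearly independent normal vectors $\nu_1,\dots,\nu_{n-\ell}$ of $\triangle_\ell$. Then a field $\tau\in P_k^*(K;\mathbb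 S)$ is uniquely determined by the following degrees of freedom: 1. for each $\triangle_\ell$, $0\le\ell\le n-1$, the mean moments $\frac1{|\triangle_\ell|}\int_{\triangle_\ell} g\,q\,ds$, $q\in P_{k+n-\ell-2}(\triangle_\ell)$ (for $\ell=0$: the value at the vertex times $q$), of the components $g=t_l^T\tau\nu_i$ ($1\le l\le\ell$, $1\le i\le n-\ell$) and $g=\nu_i^T\tau\nu_j$ ($1\le i\le j\le n-\ell$); these are $\left(\binom{n+1-\ell}{2}+\ell(n-\ell)\right)\binom{k+n-2}{\ell}=\frac{(n-\ell)(n+\ell+1)}2\binom{k+n-2}{\ell}$ degrees of freedom for each $\triangle_\ell$; 2. the values $\int_K\tau:\theta\,dx$ for $\theta\in\epsilon(P_{k-1}(K;\mathbb R^n))$; these are $n\binom{n+k-1}{n}-\frac{n(n+1)}2$ degrees of freedom; 3. the values $\int_K\tau:\theta\,dx$ for $\theta\in M_k(K)$; these are $\frac{(k+2n-3)!}{n!\,(k+n-3)!}\frac{n(n+1)}2+\frac{n(n+1)}2-n\frac{(k+2n-2)!}{n!\,(k+n-2)!}$ degrees of freedom. Precisely: for any prescribed linear functionals on the spaces $P_{k+n-\ell-2}(\triangle_\ell)$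 (one for each $\triangle_\ell$ and each component listed in 1), on $\epsilon(P_{k-1}(K;\mathbb R^n))$ and on $M_k(K)$, there is exactly one $\tau\in P_k^*(K;\mathbb S)$ whose data 1–3 are the prescribed functionals; and the numbers of degrees of freedom in 1–3 are the dimensions of the corresponding spaces of data. -/

import Mathlib

open MeasureTheory

noncomputable section

namespace SymTensorElement

/-- Euclidean space `ℝⁿ`. -/
abbrev E (n : ℕ) : Type := EuclideanSpace ℝ (Fin n)

/-- Real polynomials in `n` variables. A polynomial function on a nondegenerate simplex of `ℝⁿ`
(which has nonempty interior) comes from exactly one of them. -/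
abbrev Poly (n : ℕ) : Type := MvPolynomial (Fin n) ℝ

/-- Polynomial vector fields. -/
abbrev VecField (n : ℕ) : Type := Fin n → Poly n

/-- Polynomial matrix fields. -/
abbrev MatField (n : ℕ) : Type := Matrix (Fin n) (Fin n) (Poly n)

/-- The value of a polynomial at a point of `ℝⁿ`. -/
def pval {n : ℕ} (p : Poly n) (x : E n) : ℝ := MvPolynomial.eval (fun i => x i) p

/-- The value of a matrix field at a point of `ℝⁿ`. -/
def mval {n : ℕ} (τ : MatField n) (x : E n) : Matrix (Fin n) (Fin n) ℝ :=
  Matrix.of fun i j => pval (τ i j) x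

/-- The row-wise divergence, `(div τ)ᵢ = ∑ⱼ ∂ⱼ τᵢⱼ`. -/
def divg {n : ℕ} : MatField n →ₗ[ℝ] VecField n where
  toFun τ i := ∑ j, MvPolynomial.pderiv j (τ i j)
  map_add' σ τ := by
    funext i
    simp [Finset.sum_add_distrib]
  map_smul' c τ := by
    funext i
    simp [Finset.smul_sum]

/-- The symmetric gradient, `ε(v)ᵢⱼ = (∂ⱼ vᵢ + ∂ᵢ vⱼ) / 2`. -/
def symGrad {n : ℕ} : VecField n →ₗ[ℝ] MatField n where
  toFun v := Matrix.of fun i j =>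
    (1 / 2 : ℝ) • (MvPolynomial.pderiv j (v i) + MvPolynomial.pderiv i (v j))
  map_add' u v := by
    ext1 i j
    simp only [Matrix.of_apply, Matrix.add_apply, Pi.add_apply, map_add, ← smul_add]
    congr 1
    abel
  map_smul' c v := by
    ext1 i j
    simp only [Matrix.of_apply, Matrix.smul_apply, Pi.smul_apply, RingHom.id_apply]
    rw [Derivation.map_smul, Derivation.map_smul, ← smul_add, smul_comm]

/-- `P_m(K; ℝⁿ)`: vector fields with components of total degree at most `m`. -/
def PVec (n m : ℕ) : Submodule ℝ (VecField n) :=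
  Submodule.pi Set.univ fun _ => MvPolynomial.restrictTotalDegree (Fin n) ℝ m

/-- Symmetric matrix fields. -/
def symFields (n : ℕ) : Submodule ℝ (MatField n) where
  carrier := {τ | τ.IsSymm}
  add_mem' hσ hτ := hσ.add hτ
  zero_mem' := Matrix.isSymm_zero
  smul_mem' c _ hτ := hτ.smul c

/-- Matrix fields all of whose entries are linear combinations of monomials whose total degree
lies in `D`. -/
def degFields (n : ℕ) (D : Set ℕ) : Submodule ℝ (MatField n) where
  carrier := {τ | ∀ i j, τ i j ∈ MvPolynomial.restrictSupport ℝ {d : Fin n →₀ ℕ | d.degree ∈ D}}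
  add_mem' hσ hτ i j := Submodule.add_mem _ (hσ i j) (hτ i j)
  zero_mem' _ _ := Submodule.zero_mem _
  smul_mem' c _ hτ i j := Submodule.smul_mem _ c (hτ i j)

/-- `P_k(K; 𝕊)`: symmetric matrix fields with entries of total degree at most `k`. -/
def PSym (n k : ℕ) : Submodule ℝ (MatField n) :=
  symFields n ⊓ degFields n (Set.Iic k)

/-- The divergence-free symmetric fields of degree `k + 1` to `k + n - 1`. -/
def highDivFree (n k : ℕ) : Submodule ℝ (MatField n) :=
  symFields n ⊓ degFields n (Set.Icc (k + 1) (k + n - 1)) ⊓ LinearMap.ker divg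

/-- The enriched space `P_k^*(K; 𝕊)`. -/
def PStar (n k : ℕ) : Submodule ℝ (MatField n) :=
  PSym n k ⊔ highDivFree n k

/-- The space `ε(P_{k-1}(K; ℝⁿ))`. -/
def epsSpace (n k : ℕ) : Submodule ℝ (MatField n) :=
  (PVec n (k - 1)).map symGrad

/-- The closed simplex `K` as a point set. -/
def body {n : ℕ} (K : Affine.Simplex ℝ (E n) n) : Set (E n) :=
  convexHull ℝ (Set.range K.points)

/-- The closed subsimplex of `K` spanned by the vertices with index in `s`. -/
def faceSet {n : ℕ} (K : Affine.Simplex ℝ (E n) n) (s : Finset (Fin (n + 1))) : Set (E n) :=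
  convexHull ℝ (K.points '' (s : Set (Fin (n + 1))))

/-- The vectors tangent to the subsimplex of `K` spanned by the vertices with index in `s`. -/
def tangents {n : ℕ} (K : Affine.Simplex ℝ (E n) n) (s : Finset (Fin (n + 1))) :
    Submodule ℝ (E n) :=
  vectorSpan ℝ (K.points '' (s : Set (Fin (n + 1))))

/-- The vectors normal to the subsimplex of `K` spanned by the vertices with index in `s`. -/
def normals {n : ℕ} (K : Affine.Simplex ℝ (E n) n) (s : Finset (Fin (n + 1))) :
    Submodule ℝ (E n) :=
  (tangents K s)ᗮ

/-- `M_k(K)`: the divergence-free fields `τ` in `P_k^*(K; 𝕊)` with `τ ν = 0` on `∂K`, that is, on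
each facet of `K` (the one opposite to vertex `i`) for the vectors `ν` normal to that facet. -/
def MSpace {n : ℕ} (K : Affine.Simplex ℝ (E n) n) (k : ℕ) : Submodule ℝ (MatField n) where
  carrier := {τ | τ ∈ PStar n k ∧ divg τ = 0 ∧ ∀ i : Fin (n + 1), ∀ x ∈ faceSet K {i}ᶜ,
    ∀ ν ∈ normals K {i}ᶜ, (mval τ x).mulVec ν.ofLp = 0}
  add_mem' := by
    rintro σ τ ⟨h1, h2, h3⟩ ⟨g1, g2, g3⟩
    refine ⟨add_mem h1 g1, by simp [h2, g2], fun i x hx ν hν => ?_⟩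
    have h : mval (σ + τ) x = mval σ x + mval τ x := by
      ext a b
      simp [mval, pval]
    rw [h, Matrix.add_mulVec, h3 i x hx ν hν, g3 i x hx ν hν, add_zero]
  zero_mem' := by
    refine ⟨zero_mem _, map_zero _, fun i x _ ν _ => ?_⟩
    have h : mval (0 : MatField n) x = 0 := by
      ext a b
      simp [mval, pval]
    rw [h, Matrix.zero_mulVec]
  smul_mem' := by
    rintro c τ ⟨h1, h2, h3⟩
    refine ⟨Submodule.smul_mem _ c h1, by simp [h2], fun i x hx ν hν => ?_⟩
    have h : mval (c • τ) x = c • mval τ x := by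
      ext a b
      simp [mval, pval, MvPolynomial.smul_eval]
    rw [h, Matrix.smul_mulVec, h3 i x hx ν hν, smul_zero]

/-- `∫_K τ : θ dx`. -/
def inner2 {n : ℕ} (K : Affine.Simplex ℝ (E n) n) (τ θ : MatField n) : ℝ :=
  ∫ x in body K, ∑ i, ∑ j, mval τ x i j * mval θ x i j

/-- The `ℓ`-dimensional subsimplices of an `n`-dimensional simplex, as sets of vertices. -/
abbrev Sub (n ℓ : ℕ) : Type := {s : Finset (Fin (n + 1)) // s.card = ℓ + 1}

/-- `P_m(F)`: the functions on `F` that are restrictions of polynomials of degree at most `m`. -/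
def PolyOn {n : ℕ} (F : Set (E n)) (m : ℕ) : Submodule ℝ (F → ℝ) where
  carrier := {q | ∃ p : Poly n, p.totalDegree ≤ m ∧ ∀ x : F, q x = pval p x}
  add_mem' := by
    rintro a b ⟨p, hp, h⟩ ⟨q, hq, g⟩
    exact ⟨p + q, (MvPolynomial.totalDegree_add p q).trans (max_le hp hq), fun x => by
      simp [h, g, pval]⟩
  zero_mem' := ⟨0, by simp, fun x => by simp [pval]⟩
  smul_mem' := by
    rintro c a ⟨p, hp, h⟩
    exact ⟨c • p, (MvPolynomial.totalDegree_smul_le c p).trans hp, fun x => by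
      simp [h, pval, MvPolynomial.smul_eval]⟩

/-- The mean of `g` over `F` for the `ℓ`-dimensional Euclidean surface measure (for `ℓ = 0`, when
`F` is a point, the value of `g` there). -/
def mean {n : ℕ} (F : Set (E n)) (ℓ : ℕ) (g : F → ℝ) : ℝ :=
  ⨍ x : F, g x ∂((μHE[ℓ] : Measure (E n)).comap (Subtype.val : F → E n))

/-- Index set for the tangential-normal components (pairs `(l, i)`) and the normal-normal
components (pairs `i ≤ j`) on an `ℓ`-dimensional subsimplex. -/
abbrev Comp (n ℓ : ℕ) : Type :=
  (Fin ℓ × Fin (n - ℓ)) ⊕ {p : Fin (n - ℓ) × Fin (n - ℓ) // p.1 ≤ p.2}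

/-- The components `t_lᵀ τ ν_i` and `ν_iᵀ τ ν_j` of a matrix field at a point. -/
def component {n ℓ : ℕ} (t : Fin ℓ → E n) (ν : Fin (n - ℓ) → E n) (τ : MatField n) (x : E n) :
    Comp n ℓ → ℝ
  | Sum.inl a => dotProduct (t a.1).ofLp ((mval τ x).mulVec (ν a.2).ofLp)
  | Sum.inr a => dotProduct (ν a.1.1).ofLp ((mval τ x).mulVec (ν a.1.2).ofLp)

end SymTensorElement

end

/-!
Write `m = k + n - 1`. The enriched space consists of the symmetric fields of degree at most `m`
whose divergence has degree at most `k - 1` (`mem_PStar`), because the part of degree above `k` of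
such a field has a divergence with no terms of degree below `k`. Everything rests on *bubble
fields* `∑ λᵢ λⱼ qᵢⱼ tᵢⱼ tᵢⱼᵀ`, where `λᵢ` are the barycentric coordinates, `tᵢⱼ` are the edge
vectors of `K` and `qᵢⱼ` has degree at most `m - 2`. The matrices `tᵢⱼ tᵢⱼᵀ` form a basis of the
symmetric matrices, the coefficients of `τ` being `-∇λᵢᵀ τ ∇λⱼ`, and so the bubble fields are
exactly the symmetric fields of degree at most `m` with `τ ν = 0` on `∂K`
(`exists_bubbleField_eq`).

*Boundary moments.* The first group of degrees of freedom is unisolvent modulo bubble fields. If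
the moments of a field vanish, then by induction on the dimension its components on a subsimplex
vanish on the boundary of the subsimplex, so they are multiples `b q` of the bubble function `b`,
and testing with `q` gives zero (`mulVec_eq_zero_of_moments`). Arbitrary moments are attained by
adding fields `b p S` with constant symmetric `S`, one subsimplex after the other in the order of
increasing dimension (`exists_moments_eq`). The divisibility by `b` and the dimensions of
polynomial spaces come from the Bernstein form of a polynomial (`exists_bern_eq`,
`coeff_eq_zero_of_vanish`).

*Divergence of bubble fields.* For a bubble field, `∫ τ : ε(v) = -∫ div τ · v`
(`formM_bubbleField_symGrad`). This needs only that the derivative of `λᵢ λⱼ p` along the edge `ij`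
has integral zero over `K`, which follows by integrating along the lines parallel to the edge
(`intK_dirDeriv_edge`). If `v` is orthogonal to the divergences of all bubble fields, the bubble
field with coefficients `qᵢⱼ = tᵢⱼᵀ ε(v) tᵢⱼ` shows that `ε(v) = 0`. So the divergences of bubble
fields are the vector fields of degree at most `m - 1` orthogonal to the rigid motions
(`exists_divg_bubMap_eq`); counting dimensions gives that of `M_k(K)`, the space of divergence-free
bubble fields (`MSpace_eq`, `finrank_MSpace`).

*Unisolvence.* If all degrees of freedom of `τ` vanish, then `τ` is a bubble field, Green's formula
with `v = div τ` gives `div τ = 0`, so `τ ∈ M_k(K)` and `∫ τ : τ = 0` (`eq_zero_of_dofs_eq_zero`).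
Conversely, a field with the prescribed boundary moments is corrected by a bubble field with
suitable divergence and then by an element of `M_k(K)` (`exists_dofs_eq`).
-/

namespace SymTensorElement

/-! ### Definite bilinear forms in finite dimension -/

/-- A definite form on a finite-dimensional space represents every linear functional. -/
theorem exists_represents {V : Type*} [AddCommGroup V] [Module ℝ V] [FiniteDimensional ℝ V]
    (B : V →ₗ[ℝ] V →ₗ[ℝ] ℝ) (hB : ∀ v, B v v = 0 → v = 0) (φ : Module.Dual ℝ V) :
    ∃ v, B v = φ := by
  have hinj : Function.Injective B := by
    rw [← LinearMap.ker_eq_bot, LinearMap.ker_eq_bot']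
    intro v hv
    exact hB v (by rw [hv]; rfl)
  exact (LinearMap.injective_iff_surjective_of_finrank_eq_finrank
    (Subspace.dual_finrank_eq (K := ℝ) (V := V)).symm).1 hinj φ

theorem nondegenerate_of_definite {V : Type*} [AddCommGroup V] [Module ℝ V]
    [FiniteDimensional ℝ V] (B : LinearMap.BilinForm ℝ V) (hB : ∀ v, B v v = 0 → v = 0) :
    B.Nondegenerate :=
  ⟨fun v hv => hB v (hv v), fun v hv => hB v (hv v)⟩

/-- A vector orthogonal to everything that is orthogonal to the range of `f` lies in the range. -/
theorem mem_range_of_orthogonal {V W : Type*} [AddCommGroup V] [Module ℝ V] [AddCommGroup W]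
    [Module ℝ W] [FiniteDimensional ℝ W] (B : LinearMap.BilinForm ℝ W) (hs : B.IsSymm)
    (hB : ∀ v, B v v = 0 → v = 0) (f : V →ₗ[ℝ] W) (w : W)
    (h : ∀ r, (∀ v, B (f v) r = 0) → B r w = 0) : w ∈ LinearMap.range f := by
  rw [← LinearMap.BilinForm.orthogonal_orthogonal (nondegenerate_of_definite B hB) hs.isRefl
    (LinearMap.range f)]
  intro r hr
  exact h r fun v => hr _ ⟨v, rfl⟩

theorem finrank_range_add_finrank_orthogonal {V W : Type*} [AddCommGroup V] [Module ℝ V]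
    [AddCommGroup W] [Module ℝ W] [FiniteDimensional ℝ W] (B : LinearMap.BilinForm ℝ W)
    (hB : ∀ v, B v v = 0 → v = 0) (f : V →ₗ[ℝ] W) (R : Submodule ℝ W)
    (hR : ∀ r, r ∈ R ↔ ∀ v, B (f v) r = 0) :
    Module.finrank ℝ (LinearMap.range f) + Module.finrank ℝ R = Module.finrank ℝ W := by
  have hR' : R = B.orthogonal (LinearMap.range f) := by
    ext r
    rw [hR, LinearMap.BilinForm.mem_orthogonal_iff]
    exact ⟨fun h n ⟨v, hv⟩ => hv ▸ h v, fun h v => h _ ⟨v, rfl⟩⟩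
  have := LinearMap.BilinForm.finrank_orthogonal (nondegenerate_of_definite B hB)
    (LinearMap.range f)
  have h2 := Submodule.finrank_le (LinearMap.range f)
  rw [hR']
  omega

/-! ### Barycentric coordinates -/

variable {n : ℕ}

@[simp] theorem pval_add (p q : Poly n) (x : E n) : pval (p + q) x = pval p x + pval q x := by
  simp [pval]
@[simp] theorem pval_sub (p q : Poly n) (x : E n) : pval (p - q) x = pval p x - pval q x := by
  simp [pval]
@[simp] theorem pval_mul (p q : Poly n) (x : E n) : pval (p * q) x = pval p x * pval q x := by
  simp [pval]
@[simp] theorem pval_smul (c : ℝ) (p : Poly n) (x : E n) : pval (c • p) x = c * pval p x := by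
  simp [pval, MvPolynomial.smul_eval]
@[simp] theorem pval_pow (p : Poly n) (r : ℕ) (x : E n) : pval (p ^ r) x = pval p x ^ r := by
  simp [pval]
@[simp] theorem pval_C (c : ℝ) (x : E n) : pval (MvPolynomial.C c : Poly n) x = c := by
  simp [pval]
@[simp] theorem pval_X (j : Fin n) (x : E n) : pval (MvPolynomial.X j : Poly n) x = x j := by
  simp [pval]
@[simp] theorem pval_zero (x : E n) : pval (0 : Poly n) x = 0 := by simp [pval]
@[simp] theorem pval_one (x : E n) : pval (1 : Poly n) x = 1 := by simp [pval]
@[simp] theorem pval_sum {ι : Type*} (s : Finset ι) (p : ι → Poly n) (x : E n) :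
    pval (∑ i ∈ s, p i) x = ∑ i ∈ s, pval (p i) x := by
  simp [pval]
@[simp] theorem pval_prod {ι : Type*} (s : Finset ι) (p : ι → Poly n) (x : E n) :
    pval (∏ i ∈ s, p i) x = ∏ i ∈ s, pval (p i) x := by
  simp [pval, map_prod]

theorem poly_ext {p q : Poly n} (h : ∀ x, pval p x = pval q x) : p = q :=
  MvPolynomial.funext fun x => h (WithLp.toLp 2 x)

theorem continuous_pval (p : Poly n) : Continuous (pval p) := by
  unfold pval
  exact (MvPolynomial.continuous_eval p).comp (by fun_prop)

/-- The vertices of `K` as an affine basis of `ℝⁿ`. -/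
noncomputable def bary (K : Affine.Simplex ℝ (E n) n) : AffineBasis (Fin (n + 1)) ℝ (E n) :=
  ⟨K.points, K.independent, K.span_eq_top (by simp)⟩

variable (K : Affine.Simplex ℝ (E n) n)

@[simp] theorem bary_apply (i : Fin (n + 1)) : bary K i = K.points i := rfl

/-- The gradient of the barycentric coordinate `λᵢ`. -/
noncomputable def grad (i : Fin (n + 1)) : Fin n → ℝ :=
  fun j => ((bary K).coord i).linear (EuclideanSpace.single j 1)

/-- The barycentric coordinate `λᵢ` as a polynomial. -/
noncomputable def lam (i : Fin (n + 1)) : Poly n :=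
  MvPolynomial.C ((bary K).coord i 0) + ∑ j, MvPolynomial.C (grad K i j) * MvPolynomial.X j

theorem coord_linear_eq (i : Fin (n + 1)) (x : E n) :
    ((bary K).coord i).linear x = dotProduct (grad K i) x.ofLp := by
  conv_lhs => rw [← (EuclideanSpace.basisFun (Fin n) ℝ).sum_repr x]
  simp [grad, dotProduct, mul_comm]

@[simp] theorem pval_lam (i : Fin (n + 1)) (x : E n) : pval (lam K i) x = (bary K).coord i x := by
  have h := congrFun ((bary K).coord i).decomp x
  rw [h]
  simp only [Pi.add_apply]
  rw [coord_linear_eq]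
  simp [lam, dotProduct, add_comm]

@[simp] theorem pderiv_lam (i : Fin (n + 1)) (j : Fin n) :
    MvPolynomial.pderiv j (lam K i) = MvPolynomial.C (grad K i j) := by
  simp [lam, MvPolynomial.pderiv_X, Pi.single_apply]

theorem sum_lam : ∑ i, lam K i = 1 :=
  poly_ext fun x => by simp [(bary K).sum_coord_apply_eq_one x]

theorem sum_grad : ∑ i, grad K i = 0 := by
  funext j
  have h := congrArg (MvPolynomial.pderiv j) (sum_lam K)
  simp only [map_sum, pderiv_lam, MvPolynomial.pderiv_one] at h
  rw [← map_sum, MvPolynomial.C_eq_zero] at h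
  rw [Finset.sum_apply, h, Pi.zero_apply]

theorem X_eq_sum_lam (j : Fin n) :
    (MvPolynomial.X j : Poly n) = ∑ i, MvPolynomial.C (K.points i j) * lam K i :=
  poly_ext fun x => by
    have h := congrArg (fun y : E n => y j) ((bary K).linear_combination_coord_eq_self x)
    simp only [bary_apply, PiLp.smul_apply, WithLp.ofLp_sum, Finset.sum_apply, smul_eq_mul] at h
    simp [mul_comm, ← h]

theorem totalDegree_lam_le (i : Fin (n + 1)) : (lam K i).totalDegree ≤ 1 := by
  unfold lam
  refine (MvPolynomial.totalDegree_add _ _).trans (max_le (by simp) ?_)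
  refine MvPolynomial.totalDegree_finsetSum_le fun j _ => ?_
  refine (MvPolynomial.totalDegree_mul _ _).trans ?_
  simp [MvPolynomial.totalDegree_X]

/-- The edge vector from vertex `i` to vertex `j`. -/
def edge (i j : Fin (n + 1)) : Fin n → ℝ := (K.points j).ofLp - (K.points i).ofLp

theorem grad_dotProduct_edge (r i j : Fin (n + 1)) :
    dotProduct (grad K r) (edge K i j) = (if r = j then 1 else 0) - (if r = i then 1 else 0) := by
  have h := ((bary K).coord r).linearMap_vsub (K.points j) (K.points i)
  rw [coord_linear_eq, ← bary_apply, ← bary_apply, (bary K).coord_apply,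
    (bary K).coord_apply] at h
  simpa [edge] using h

theorem mem_faceSet_iff (s : Finset (Fin (n + 1))) (x : E n) :
    x ∈ faceSet K s ↔ (∀ i, 0 ≤ (bary K).coord i x) ∧ ∀ i ∉ s, (bary K).coord i x = 0 := by
  constructor
  · intro hx
    have hconv : Convex ℝ {x : E n | (∀ i, 0 ≤ (bary K).coord i x) ∧
        ∀ i ∉ s, (bary K).coord i x = 0} := by
      intro x hx y hy a b ha hb hab
      have key : ∀ i, (bary K).coord i (a • x + b • y)
          = a * (bary K).coord i x + b * (bary K).coord i y := fun i => by
        rw [Convex.combo_affine_apply hab]; simp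
      refine ⟨fun i => ?_, fun i hi => ?_⟩
      · rw [key]
        exact add_nonneg (mul_nonneg ha (hx.1 i)) (mul_nonneg hb (hy.1 i))
      · rw [key, hx.2 i hi, hy.2 i hi]; simp
    refine convexHull_min ?_ hconv hx
    rintro _ ⟨j, hj, rfl⟩
    refine ⟨fun i => ?_, fun i hi => ?_⟩
    · rw [← bary_apply, (bary K).coord_apply]; split_ifs <;> norm_num
    · rw [← bary_apply, (bary K).coord_apply, if_neg]
      rintro rfl
      exact hi hj
  · rintro ⟨h0, h1⟩
    rw [← (bary K).linear_combination_coord_eq_self x,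
      ← Finset.sum_subset (Finset.subset_univ s) fun i _ hi => by rw [h1 i hi, zero_smul]]
    refine (convex_convexHull ℝ _).sum_mem (fun i _ => h0 i) ?_
      fun i hi => subset_convexHull ℝ _ ⟨i, hi, rfl⟩
    rw [← (bary K).sum_coord_apply_eq_one x]
    exact Finset.sum_subset (Finset.subset_univ s) fun i _ hi => h1 i hi

theorem body_eq : body K = {x | ∀ i, 0 ≤ (bary K).coord i x} :=
  (bary K).convexHull_eq_nonneg_coord

theorem tangents_mono {s s' : Finset (Fin (n + 1))} (h : s ⊆ s') : tangents K s ≤ tangents K s' :=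
  vectorSpan_mono ℝ (Set.image_mono h)

theorem normals_anti {s s' : Finset (Fin (n + 1))} (h : s ⊆ s') : normals K s' ≤ normals K s :=
  Submodule.orthogonal_le (tangents_mono K h)

theorem inner_eq_dotProduct (x y : E n) : inner ℝ x y = dotProduct x.ofLp y.ofLp := by
  simp [PiLp.inner_apply, dotProduct, mul_comm]

theorem edge_mem_tangents {s : Finset (Fin (n + 1))} {i j : Fin (n + 1)} (hi : i ∈ s)
    (hj : j ∈ s) : WithLp.toLp 2 (edge K i j) ∈ tangents K s :=
  vsub_mem_vectorSpan ℝ ⟨j, hj, rfl⟩ ⟨i, hi, rfl⟩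

theorem edge_dotProduct_of_mem_normals {s : Finset (Fin (n + 1))} {i j : Fin (n + 1)}
    (hi : i ∈ s) (hj : j ∈ s) {ν : E n} (hν : ν ∈ normals K s) :
    dotProduct (edge K i j) ν.ofLp = 0 := by
  have := hν _ (edge_mem_tangents K hi hj)
  rwa [inner_eq_dotProduct] at this

theorem grad_mem_normals {s : Finset (Fin (n + 1))} {r : Fin (n + 1)} (hr : r ∉ s) :
    WithLp.toLp 2 (grad K r) ∈ normals K s := by
  rw [normals, Submodule.mem_orthogonal']
  intro u hu
  rw [tangents, vectorSpan] at hu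
  induction hu using Submodule.span_induction with
  | mem u hu =>
    obtain ⟨_, ⟨j, hj, rfl⟩, _, ⟨i, hi, rfl⟩, rfl⟩ := hu
    have h := grad_dotProduct_edge K r i j
    rw [if_neg (fun e : r = j => hr (e ▸ hj)), if_neg (fun e : r = i => hr (e ▸ hi)),
      sub_zero] at h
    rw [inner_eq_dotProduct]
    exact h
  | zero => simp
  | add u v _ _ hu hv => rw [inner_add_right, hu, hv, add_zero]
  | smul c u _ hu => rw [inner_smul_right, hu, mul_zero]

/-! ### Bernstein form of polynomials on a simplex -/

/-- Substitution of the barycentric coordinates into a polynomial in `n + 1` variables. -/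
noncomputable def bern : MvPolynomial (Fin (n + 1)) ℝ →ₐ[ℝ] Poly n := MvPolynomial.aeval (lam K)

theorem pval_bern (P : MvPolynomial (Fin (n + 1)) ℝ) (x : E n) :
    pval (bern K P) x = MvPolynomial.eval (fun i => (bary K).coord i x) P := by
  unfold bern
  induction P using MvPolynomial.induction_on with
  | C a => simp [MvPolynomial.algebraMap_eq]
  | add p q hp hq => rw [map_add, pval_add, hp, hq, map_add]
  | mul_X p i hp => rw [map_mul, pval_mul, hp, map_mul, MvPolynomial.aeval_X, pval_lam,
      MvPolynomial.eval_X]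

/-- The space of Bernstein forms of degree `m` in the barycentric coordinates indexed by `s`. -/
noncomputable abbrev bernForms (s : Finset (Fin (n + 1))) (m : ℕ) :
    Submodule ℝ (MvPolynomial (Fin (n + 1)) ℝ) :=
  MvPolynomial.restrictSupport ℝ (s.finsuppAntidiag m : Set (Fin (n + 1) →₀ ℕ))

theorem mem_bernForms {s : Finset (Fin (n + 1))} {m : ℕ} {P : MvPolynomial (Fin (n + 1)) ℝ} :
    P ∈ bernForms s m ↔ ∀ d ∈ P.support, ∑ i ∈ s, d i = m ∧ d.support ⊆ s := by
  simp [MvPolynomial.mem_restrictSupport_iff, Set.subset_def]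

theorem mem_bernForms_univ_of_isHomogeneous {m : ℕ} {P : MvPolynomial (Fin (n + 1)) ℝ}
    (hP : P.IsHomogeneous m) : P ∈ bernForms Finset.univ m := by
  rw [mem_bernForms]
  intro d hd
  refine ⟨?_, Finset.subset_univ _⟩
  rw [← Finsupp.degree_eq_sum]
  by_contra h
  exact MvPolynomial.mem_support_iff.1 hd (hP.coeff_eq_zero h)

theorem totalDegree_bern_le {m : ℕ} {s : Finset (Fin (n + 1))}
    {P : MvPolynomial (Fin (n + 1)) ℝ} (hP : P ∈ bernForms s m) :
    (bern K P).totalDegree ≤ m := by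
  rw [mem_bernForms] at hP
  rw [bern, MvPolynomial.aeval_def, MvPolynomial.eval₂_eq']
  refine MvPolynomial.totalDegree_finsetSum_le fun d hd => ?_
  refine (MvPolynomial.totalDegree_mul _ _).trans ?_
  rw [MvPolynomial.algebraMap_eq, MvPolynomial.totalDegree_C, zero_add]
  refine (MvPolynomial.totalDegree_finsetProd _ _).trans ?_
  rw [← (hP d hd).1, Finset.sum_subset (Finset.subset_univ s) fun i _ hi => by
    by_contra h
    exact hi ((hP d hd).2 (Finsupp.mem_support_iff.2 h))]
  refine Finset.sum_le_sum fun i _ => (MvPolynomial.totalDegree_pow _ _).trans ?_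
  simpa using Nat.mul_le_mul_left (d i) (totalDegree_lam_le K i)

/-- Homogenization by means of `∑ λᵢ = 1` gives every polynomial of degree at most `m` a
Bernstein form of degree `m`. -/
theorem exists_bern_eq {m : ℕ} {p : Poly n} (hp : p.totalDegree ≤ m) :
    ∃ P ∈ bernForms Finset.univ m, bern K P = p := by
  let Y : Fin n → MvPolynomial (Fin (n + 1)) ℝ := fun j =>
    ∑ i, MvPolynomial.C (K.points i j) * MvPolynomial.X i
  let S : MvPolynomial (Fin (n + 1)) ℝ := ∑ i, MvPolynomial.X i
  have hY : ∀ j, (Y j).IsHomogeneous 1 := fun j =>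
    MvPolynomial.IsHomogeneous.sum _ _ _ fun i _ => (MvPolynomial.isHomogeneous_X _ _).C_mul _
  have hS : S.IsHomogeneous 1 :=
    MvPolynomial.IsHomogeneous.sum _ _ _ fun i _ => MvPolynomial.isHomogeneous_X _ _
  have bY : ∀ j, bern K (Y j) = MvPolynomial.X j := fun j => by
    rw [X_eq_sum_lam K j]
    simp [Y, bern, MvPolynomial.algebraMap_eq]
  have bS : bern K S = 1 := by
    rw [← sum_lam K]
    simp [S, bern]
  -- `Y j` and `S` turn into `X j` and `1`, so each monomial may be raised to degree `m` by `S`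
  refine ⟨∑ d ∈ p.support, MvPolynomial.C (p.coeff d) *
    ((∏ j, Y j ^ d j) * S ^ (m - ∑ j, d j)), ?_, ?_⟩
  · apply mem_bernForms_univ_of_isHomogeneous
    refine MvPolynomial.IsHomogeneous.sum _ _ _ fun d hd => MvPolynomial.IsHomogeneous.C_mul ?_ _
    have h1 : ∑ j, d j ≤ m := by
      refine le_trans ?_ hp
      have := MvPolynomial.le_totalDegree hd
      rwa [Finsupp.sum_fintype _ _ fun _ => rfl] at this
    have h2 := (MvPolynomial.IsHomogeneous.prod Finset.univ (fun j => Y j ^ d j)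
      (fun j => 1 * d j) fun j _ => (hY j).pow _).mul (hS.pow (m - ∑ j, d j))
    simp only [one_mul] at h2
    rwa [Nat.add_sub_cancel' h1] at h2
  · conv_rhs => rw [p.as_sum]
    simp only [map_sum, map_mul, map_prod, map_pow, bY, bS, one_pow, mul_one]
    refine Finset.sum_congr rfl fun d _ => ?_
    rw [MvPolynomial.monomial_eq, Finsupp.prod_fintype _ _ fun _ => pow_zero _]
    simp [bern, MvPolynomial.algebraMap_eq]

/-- A Bernstein form that vanishes on a subsimplex has no coefficient supported on it. -/
theorem coeff_eq_zero_of_vanish {m : ℕ} {s : Finset (Fin (n + 1))} (hs : s.Nonempty)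
    {P : MvPolynomial (Fin (n + 1)) ℝ} (hP : P ∈ bernForms Finset.univ m)
    (h0 : ∀ x ∈ faceSet K s, pval (bern K P) x = 0) {d : Fin (n + 1) →₀ ℕ}
    (hd : d.support ⊆ s) : P.coeff d = 0 := by
  rw [mem_bernForms] at hP
  -- the part of `P` supported on `s` vanishes at all points with positive coordinates
  let Q : MvPolynomial (Fin (n + 1)) ℝ :=
    ∑ e ∈ P.support with e.support ⊆ s, MvPolynomial.monomial e (P.coeff e)
  have hQ : Q = 0 := by
    refine MvPolynomial.funext_set (fun _ => Set.Ioi (0 : ℝ)) (fun _ => Set.Ioi_infinite 0)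
      fun z hz => ?_
    have hz : ∀ i, 0 < z i := fun i => hz i trivial
    let σ : ℝ := ∑ i ∈ s, z i
    have hσ : 0 < σ := Finset.sum_pos (fun i _ => hz i) hs
    let w : Fin (n + 1) → ℝ := fun i => if i ∈ s then z i / σ else 0
    have hw1 : ∑ i, w i = 1 := by
      simp only [w, Finset.sum_ite_mem, Finset.univ_inter, ← Finset.sum_div]
      exact div_self hσ.ne'
    let x : E n := Finset.univ.affineCombination ℝ (bary K) w
    have hx : ∀ i, (bary K).coord i x = w i := fun i =>
      (bary K).coord_apply_combination_of_mem (Finset.mem_univ i) hw1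
    have hxs : x ∈ faceSet K s := by
      rw [mem_faceSet_iff]
      simp only [hx]
      refine ⟨fun i => ?_, fun i hi => if_neg hi⟩
      by_cases h : i ∈ s
      · simp only [w, if_pos h]
        exact (div_pos (hz i) hσ).le
      · simp only [w, if_neg h, le_refl]
    have h1 := h0 x hxs
    rw [pval_bern] at h1
    simp only [hx] at h1
    rw [MvPolynomial.eval_eq'] at h1
    rw [map_zero, map_sum, Finset.sum_filter]
    have h2 : σ ^ m * ∑ d ∈ P.support, P.coeff d * ∏ i, w i ^ d i = 0 := by rw [h1, mul_zero]
    refine Eq.trans ?_ h2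
    rw [Finset.mul_sum]
    refine Finset.sum_congr rfl fun e he => ?_
    split_ifs with hes
    · rw [MvPolynomial.eval_monomial, Finsupp.prod_fintype _ _ fun _ => pow_zero _,
        ← (hP e he).1, ← Finset.prod_pow_eq_pow_sum, mul_left_comm, ← Finset.prod_mul_distrib]
      congr 1
      refine Finset.prod_congr rfl fun i _ => ?_
      by_cases h : i ∈ s
      · rw [← mul_pow]
        simp only [w, if_pos h, mul_div_cancel₀ _ hσ.ne']
      · have : e i = 0 := by
          by_contra h'
          exact h (hes (Finsupp.mem_support_iff.2 h'))
        simp [this]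
    · obtain ⟨i, hi, his⟩ := Finset.not_subset.1 hes
      have hwi : w i = 0 := if_neg his
      rw [Finset.prod_eq_zero (Finset.mem_univ i), mul_zero, mul_zero]
      rw [hwi]
      exact zero_pow (Finsupp.mem_support_iff.1 hi)
  have hc : Q.coeff d = P.coeff d := by
    simp only [Q, MvPolynomial.coeff_sum, MvPolynomial.coeff_monomial]
    rw [Finset.sum_ite_eq']
    by_cases h : d ∈ P.support
    · rw [if_pos (Finset.mem_filter.2 ⟨h, hd⟩)]
    · rw [if_neg fun h' => h (Finset.mem_filter.1 h').1, MvPolynomial.notMem_support_iff.1 h]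
  rw [← hc, hQ, MvPolynomial.coeff_zero]

/-- On a subsimplex only the part of a Bernstein form supported there matters. -/
theorem pval_bern_eq_sum {s : Finset (Fin (n + 1))} (P : MvPolynomial (Fin (n + 1)) ℝ) {x : E n}
    (hx : x ∈ faceSet K s) :
    pval (bern K P) x = ∑ d ∈ P.support with d.support ⊆ s,
      P.coeff d * ∏ i, (bary K).coord i x ^ d i := by
  rw [pval_bern, MvPolynomial.eval_eq', Finset.sum_filter]
  refine Finset.sum_congr rfl fun d _ => ?_
  split_ifs with h
  · rfl
  · obtain ⟨i, hi, his⟩ := Finset.not_subset.1 h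
    rw [Finset.prod_eq_zero (Finset.mem_univ i), mul_zero]
    rw [((mem_faceSet_iff K s x).1 hx).2 i his]
    exact zero_pow (Finsupp.mem_support_iff.1 hi)

/-- The bubble function of a subsimplex, the product of its barycentric coordinates. -/
noncomputable def bub (s : Finset (Fin (n + 1))) : Poly n := ∏ i ∈ s, lam K i

/-- A polynomial that vanishes on the facets of a simplex opposite to the vertices in `s` is
divisible there by the product of the barycentric coordinates of these vertices. -/
theorem exists_eq_bub_mul {m : ℕ} (hm : 0 < m) {s f : Finset (Fin (n + 1))}
    {p : Poly n} (hp : p.totalDegree ≤ m)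
    (h0 : ∀ i ∈ s, ∀ x ∈ faceSet K (f.erase i), pval p x = 0) :
    ∃ q : Poly n, q.totalDegree ≤ m - s.card ∧
      ∀ x ∈ faceSet K f, pval p x = pval (bub K s * q) x := by
  obtain ⟨P, hP, rfl⟩ := exists_bern_eq K hp
  have hP' := mem_bernForms.1 hP
  refine ⟨∑ d ∈ P.support with s ⊆ d.support, MvPolynomial.C (P.coeff d) *
    ∏ i, lam K i ^ (d i - if i ∈ s then 1 else 0), ?_, fun x hx => ?_⟩
  · refine MvPolynomial.totalDegree_finsetSum_le fun d hd => ?_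
    obtain ⟨hdP, hds⟩ := Finset.mem_filter.1 hd
    refine (MvPolynomial.totalDegree_mul _ _).trans ?_
    rw [MvPolynomial.totalDegree_C, zero_add]
    refine (MvPolynomial.totalDegree_finsetProd _ _).trans ?_
    have h1 : ∀ i ∈ Finset.univ, (lam K i ^ (d i - if i ∈ s then 1 else 0)).totalDegree ≤
        d i - if i ∈ s then 1 else 0 := fun i _ =>
      (MvPolynomial.totalDegree_pow _ _).trans
        (by simpa using Nat.mul_le_mul_left (d i - _) (totalDegree_lam_le K i))
    refine (Finset.sum_le_sum h1).trans ?_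
    have h2 : ∑ i, (d i - if i ∈ s then 1 else 0) + s.card = m := by
      have hc : s.card = ∑ i, if i ∈ s then 1 else 0 := by simp
      rw [← (hP' d hdP).1, hc, ← Finset.sum_add_distrib]
      refine Finset.sum_congr rfl fun i _ => Nat.sub_add_cancel ?_
      split_ifs with hi
      · exact Nat.pos_of_ne_zero (Finsupp.mem_support_iff.1 (hds hi))
      · exact Nat.zero_le _
    omega
  · rw [pval_bern_eq_sum K P hx, pval_mul, pval_sum, Finset.mul_sum, Finset.sum_filter,
      Finset.sum_filter]
    refine Finset.sum_congr rfl fun d hd => ?_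
    have hbub : pval (bub K s) x = ∏ i, (bary K).coord i x ^ (if i ∈ s then 1 else 0) := by
      simp only [bub, pval_prod, pval_lam, pow_ite, pow_one, pow_zero, Finset.prod_ite_mem,
        Finset.univ_inter]
    have hzero : ¬ d.support ⊆ f → ∏ i, (bary K).coord i x ^ d i = 0 := fun h => by
      obtain ⟨i, hi, hif⟩ := Finset.not_subset.1 h
      refine Finset.prod_eq_zero (Finset.mem_univ i) ?_
      rw [((mem_faceSet_iff K f x).1 hx).2 i hif]
      exact zero_pow (Finsupp.mem_support_iff.1 hi)
    by_cases h : s ⊆ d.support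
    · have key : pval (bub K s) x * pval (MvPolynomial.C (P.coeff d) *
          ∏ i, lam K i ^ (d i - if i ∈ s then 1 else 0)) x =
          P.coeff d * ∏ i, (bary K).coord i x ^ d i := by
        rw [pval_mul, pval_C, mul_left_comm, hbub, pval_prod, ← Finset.prod_mul_distrib]
        congr 1
        refine Finset.prod_congr rfl fun i _ => ?_
        rw [pval_pow, pval_lam, ← pow_add, Nat.add_sub_cancel']
        split_ifs with hi
        · exact Nat.pos_of_ne_zero (Finsupp.mem_support_iff.1 (h hi))
        · exact Nat.zero_le _
      rw [if_pos h, key]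
      split_ifs with h'
      · rfl
      · rw [hzero h', mul_zero]
    · rw [if_neg h]
      split_ifs with h'
      · have hne : d.support.Nonempty := by
          rw [Finset.nonempty_iff_ne_empty, Ne, Finsupp.support_eq_empty]
          rintro rfl
          have := (hP' 0 hd).1
          simp only [Finsupp.coe_zero, Pi.zero_apply, Finset.sum_const_zero] at this
          omega
        obtain ⟨i, hi, hid⟩ := Finset.not_subset.1 h
        have hd' : d.support ⊆ f.erase i := fun j hj =>
          Finset.mem_erase.2 ⟨fun e => hid (e ▸ hj), h' hj⟩
        rw [coeff_eq_zero_of_vanish K (hne.mono hd') hP (h0 i hi) hd', zero_mul]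
      · rfl

theorem bernForms_mono {s : Finset (Fin (n + 1))} {m : ℕ} :
    bernForms s m ≤ bernForms Finset.univ m := by
  intro P hP
  rw [mem_bernForms] at hP ⊢
  intro d hd
  refine ⟨?_, Finset.subset_univ _⟩
  rw [← (hP d hd).1]
  symm
  refine Finset.sum_subset (Finset.subset_univ s) fun i _ hi => ?_
  by_contra h
  exact hi ((hP d hd).2 (Finsupp.mem_support_iff.2 h))

theorem finrank_bernForms (s : Finset (Fin (n + 1))) (m ℓ : ℕ) (hs : s.card = ℓ + 1) :
    Module.finrank ℝ (bernForms s m) = (m + ℓ).choose ℓ := by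
  rw [Module.finrank_eq_card_basis (MvPolynomial.basisRestrictSupport ℝ _)]
  simp only [Finset.coe_sort_coe, Fintype.card_coe]
  rw [Finset.card_finsuppAntidiag_nat_eq_choose, hs, show ℓ + 1 + m - 1 = m + ℓ by omega,
    Nat.choose_symm_add]

/-- The Bernstein forms of degree `m` on a subsimplex are its polynomials of degree at most
`m`. -/
noncomputable def bernEquiv {s : Finset (Fin (n + 1))} (hs : s.Nonempty) (m : ℕ) :
    bernForms s m ≃ₗ[ℝ] PolyOn (faceSet K s) m := by
  refine LinearEquiv.ofBijective
    { toFun := fun P => ⟨fun x => pval (bern K P.1) x,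
        ⟨_, totalDegree_bern_le K P.2, fun _ => rfl⟩⟩
      map_add' := fun P Q => by ext x; simp
      map_smul' := fun c P => by ext x; simp } ⟨?_, ?_⟩
  · rw [← LinearMap.ker_eq_bot, LinearMap.ker_eq_bot']
    rintro ⟨P, hP⟩ h
    ext d
    by_cases hd : d ∈ P.support
    · refine coeff_eq_zero_of_vanish K hs (bernForms_mono hP) (fun x hx => ?_)
        ((mem_bernForms.1 hP) d hd).2
      exact congrFun (congrArg Subtype.val h) ⟨x, hx⟩
    · exact MvPolynomial.notMem_support_iff.1 hd
  · rintro ⟨q, p, hp, hq⟩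
    obtain ⟨P, hP, rfl⟩ := exists_bern_eq K hp
    have hP' := mem_bernForms.1 hP
    refine ⟨⟨∑ d ∈ P.support with d.support ⊆ s, MvPolynomial.monomial d (P.coeff d), ?_⟩, ?_⟩
    · refine Submodule.sum_mem _ fun d hd => ?_
      obtain ⟨hd, hds⟩ := Finset.mem_filter.1 hd
      rw [MvPolynomial.monomial_mem_restrictSupport]
      refine Or.inl ?_
      rw [Finset.mem_coe, Finset.mem_finsuppAntidiag]
      refine ⟨?_, hds⟩
      rw [← (hP' d hd).1]
      refine Finset.sum_subset (Finset.subset_univ s) fun i _ hi => ?_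
      by_contra h
      exact hi (hds (Finsupp.mem_support_iff.2 h))
    · ext x
      simp only [LinearMap.coe_mk, AddHom.coe_mk]
      rw [hq, pval_bern_eq_sum K P x.2, pval_bern, map_sum]
      refine Finset.sum_congr rfl fun d _ => ?_
      rw [MvPolynomial.eval_monomial, Finsupp.prod_fintype _ _ fun _ => pow_zero _]

theorem finiteDimensional_polyOn {s : Finset (Fin (n + 1))} (hs : s.Nonempty) (m : ℕ) :
    FiniteDimensional ℝ (PolyOn (faceSet K s) m) :=
  have : Module.Finite ℝ (bernForms s m) :=
    Module.Finite.of_basis (MvPolynomial.basisRestrictSupport ℝ _)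
  Module.Finite.equiv (bernEquiv K hs m)

theorem finrank_polyOn {s : Finset (Fin (n + 1))} (m ℓ : ℕ) (hs : s.card = ℓ + 1) :
    Module.finrank ℝ (PolyOn (faceSet K s) m) = (m + ℓ).choose ℓ := by
  rw [← (bernEquiv K (Finset.card_pos.1 (by omega)) m).finrank_eq, finrank_bernForms s m ℓ hs]

theorem finrank_restrictTotalDegree (K : Affine.Simplex ℝ (E n) n) (m : ℕ) :
    Module.finrank ℝ (MvPolynomial.restrictTotalDegree (Fin n) ℝ m) = (m + n).choose n := by
  rw [← finrank_bernForms (Finset.univ : Finset (Fin (n + 1))) m n (by simp)]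
  symm
  refine LinearEquiv.finrank_eq (LinearEquiv.ofBijective
    ((bern K).toLinearMap.restrict (p := bernForms Finset.univ m) fun P hP => ?_) ⟨?_, ?_⟩)
  · rw [MvPolynomial.mem_restrictTotalDegree]
    exact totalDegree_bern_le K hP
  · rw [← LinearMap.ker_eq_bot, LinearMap.ker_eq_bot']
    rintro ⟨P, hP⟩ h
    ext d
    refine coeff_eq_zero_of_vanish K Finset.univ_nonempty hP (fun x _ => ?_)
      (Finset.subset_univ _)
    have : bern K P = 0 := congrArg Subtype.val h
    rw [this, pval_zero]
  · rintro ⟨p, hp⟩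
    obtain ⟨P, hP, rfl⟩ := exists_bern_eq K ((MvPolynomial.mem_restrictTotalDegree _ _ _).1 hp)
    exact ⟨⟨P, hP⟩, rfl⟩

/-! ### Integration over subsimplices -/

theorem isCompact_faceSet (s : Finset (Fin (n + 1))) : IsCompact (faceSet K s) :=
  (s.finite_toSet.image _).isCompact_convexHull (𝕜 := ℝ)

theorem measurableSet_faceSet (s : Finset (Fin (n + 1))) : MeasurableSet (faceSet K s) :=
  (isCompact_faceSet K s).isClosed.measurableSet

theorem faceSet_univ : faceSet K Finset.univ = body K := by
  simp [faceSet, body]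

theorem finrank_tangents {s : Finset (Fin (n + 1))} {ℓ : ℕ} (hs : s.card = ℓ + 1) :
    Module.finrank ℝ (tangents K s) = ℓ := by
  classical
  have := K.independent.finrank_vectorSpan_image_finset hs
  rwa [Finset.coe_image] at this

/-- The `ℓ`-dimensional measure of an `ℓ`-dimensional simplex is finite and positive on relatively
open sets: up to an isometry it is Lebesgue measure on a convex body in the tangent space. -/
theorem euclideanHausdorffMeasure_faceSet {s : Finset (Fin (n + 1))} {ℓ : ℕ}
    (hs : s.card = ℓ + 1) :
    (μHE[ℓ] : Measure (E n)) (faceSet K s) < ⊤ ∧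
      ∀ O : Set (E n), IsOpen O → (faceSet K s ∩ O).Nonempty →
        0 < (μHE[ℓ] : Measure (E n)) (faceSet K s ∩ O) := by
  obtain ⟨i₀, hi₀⟩ : s.Nonempty := Finset.card_pos.1 (by omega)
  let W := tangents K s
  let ψ : W → E n := fun w => (w : E n) + K.points i₀
  have hψ : Isometry ψ := by
    refine Isometry.of_dist_eq fun a b => ?_
    simp only [ψ, dist_add_right]
    rfl
  let C : Set W := ψ ⁻¹' faceSet K s
  -- the subsimplex lies in the range of the isometry `ψ`
  have hsub : ∀ x ∈ faceSet K s, ∃ w, ψ w = x := fun x hx => by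
    have h1 : x ∈ affineSpan ℝ (K.points '' (s : Set (Fin (n + 1)))) :=
      convexHull_subset_affineSpan _ hx
    have h2 : K.points i₀ ∈ affineSpan ℝ (K.points '' (s : Set (Fin (n + 1)))) :=
      subset_affineSpan ℝ _ ⟨i₀, hi₀, rfl⟩
    have h3 := AffineSubspace.vsub_mem_direction h1 h2
    rw [direction_affineSpan] at h3
    exact ⟨⟨x -ᵥ K.points i₀, h3⟩, by simp [ψ]⟩
  have himg : ∀ O : Set (E n), ψ '' (C ∩ ψ ⁻¹' O) = faceSet K s ∩ O := by
    intro O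
    ext x
    constructor
    · rintro ⟨w, ⟨h1, h2⟩, rfl⟩
      exact ⟨h1, h2⟩
    · rintro ⟨h1, h2⟩
      obtain ⟨w, rfl⟩ := hsub x h1
      exact ⟨w, ⟨h1, h2⟩, rfl⟩
  have hmeas : ∀ A : Set W, (μHE[ℓ] : Measure (E n)) (ψ '' A) = volume A := by
    intro A
    rw [hψ.euclideanHausdorffMeasure_image]
    have h := InnerProductSpace.euclideanHausdorffMeasure_eq_volume (V := W)
    rw [finrank_tangents K hs] at h
    rw [h]
  have hCc : IsCompact C := hψ.isClosedEmbedding.isCompact_preimage (isCompact_faceSet K s)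
  have hCconv : Convex ℝ C := by
    intro a ha b hb u v hu hv huv
    have : ψ (u • a + v • b) = u • ψ a + v • ψ b := by
      simp only [ψ, Submodule.coe_add, Submodule.coe_smul, smul_add]
      have h1 : K.points i₀ = u • K.points i₀ + v • K.points i₀ := by
        rw [← add_smul, huv, one_smul]
      nth_rewrite 1 [h1]
      abel
    change ψ (u • a + v • b) ∈ faceSet K s
    rw [this]
    exact convex_convexHull ℝ _ ha hb hu hv huv
  have hpt : ∀ i ∈ s, ∃ w ∈ C, ψ w = K.points i := fun i hi => by
    have h : K.points i ∈ faceSet K s := subset_convexHull ℝ _ ⟨i, hi, rfl⟩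
    obtain ⟨w, hw⟩ := hsub _ h
    exact ⟨w, by rw [← hw] at h; exact h, hw⟩
  have hspan : vectorSpan ℝ C = ⊤ := by
    rw [eq_top_iff]
    rintro ⟨w, hw⟩ -
    have hw' := hw
    change w ∈ Submodule.span ℝ _ at hw'
    induction hw' using Submodule.span_induction with
    | mem w h =>
      obtain ⟨_, ⟨i, hi, rfl⟩, _, ⟨j, hj, rfl⟩, rfl⟩ := h
      obtain ⟨a, ha, ha'⟩ := hpt i hi
      obtain ⟨b, hb, hb'⟩ := hpt j hj
      convert vsub_mem_vectorSpan ℝ ha hb using 1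
      ext1
      simp only [← ha', ← hb', ψ]
      simp
    | zero => exact Submodule.zero_mem _
    | add u v hu hv h1 h2 => exact Submodule.add_mem _ (h1 hu) (h2 hv)
    | smul c u hu h => exact Submodule.smul_mem _ c (h hu)
  have hCne : C.Nonempty := by
    obtain ⟨w, hw, -⟩ := hpt i₀ hi₀
    exact ⟨w, hw⟩
  have hint : (interior C).Nonempty := by
    rw [hCconv.interior_nonempty_iff_affineSpan_eq_top,
      AffineSubspace.affineSpan_eq_top_iff_vectorSpan_eq_top_of_nonempty _ _ _ hCne]
    exact hspan
  refine ⟨?_, fun O hO hne => ?_⟩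
  · have h := himg Set.univ
    simp only [Set.preimage_univ, Set.inter_univ] at h
    rw [← h, hmeas]
    exact hCc.measure_lt_top
  · rw [← himg, hmeas]
    have hO' : IsOpen (ψ ⁻¹' O) := hO.preimage hψ.continuous
    rw [← himg, Set.image_nonempty] at hne
    obtain ⟨x, hx, hxO⟩ := hne
    have hx' : x ∈ closure (interior C) := by
      rw [hCconv.closure_interior_eq_closure_of_nonempty_interior hint]
      exact subset_closure hx
    obtain ⟨y, hyO, hyC⟩ := mem_closure_iff.1 hx' _ hO' hxO
    exact ((hO'.inter isOpen_interior).measure_pos volume ⟨y, hyO, hyC⟩).trans_le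
      (measure_mono fun z hz => ⟨interior_subset hz.2, hz.1⟩)

/-- The surface measure on a subsimplex. -/
noncomputable abbrev faceMeasure (s : Finset (Fin (n + 1))) (ℓ : ℕ) : Measure (faceSet K s) :=
  (μHE[ℓ] : Measure (E n)).comap Subtype.val

theorem faceMeasure_apply (s : Finset (Fin (n + 1))) (ℓ : ℕ) (A : Set (faceSet K s)) :
    faceMeasure K s ℓ A = (μHE[ℓ] : Measure (E n)) (Subtype.val '' A) :=
  (MeasurableEmbedding.subtype_coe (measurableSet_faceSet K s)).comap_apply _ _

theorem isFiniteMeasure_faceMeasure {s : Finset (Fin (n + 1))} {ℓ : ℕ} (hs : s.card = ℓ + 1) :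
    IsFiniteMeasure (faceMeasure K s ℓ) :=
  ⟨by
    rw [faceMeasure_apply, Subtype.coe_image_univ]
    exact (euclideanHausdorffMeasure_faceSet K hs).1⟩

theorem integrable_faceMeasure {s : Finset (Fin (n + 1))} {ℓ : ℕ} (hs : s.card = ℓ + 1)
    {g : faceSet K s → ℝ} (hg : Continuous g) : Integrable g (faceMeasure K s ℓ) := by
  have := isFiniteMeasure_faceMeasure K hs
  have := isCompact_iff_compactSpace.1 (isCompact_faceSet K s)
  exact hg.integrable_of_hasCompactSupport (HasCompactSupport.of_compactSpace g)

theorem eq_zero_of_integral_faceMeasure_eq_zero {s : Finset (Fin (n + 1))} {ℓ : ℕ}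
    (hs : s.card = ℓ + 1) {g : faceSet K s → ℝ} (hg : Continuous g) (h0 : ∀ x, 0 ≤ g x)
    (h : ∫ x, g x ∂faceMeasure K s ℓ = 0) (x : faceSet K s) : g x = 0 := by
  by_contra hx
  refine h.not_gt ((integral_pos_iff_support_of_nonneg h0
    (integrable_faceMeasure K hs hg)).2 ?_)
  obtain ⟨O, hO, hOg⟩ := isOpen_induced_iff.1 hg.isOpen_support
  rw [faceMeasure_apply, ← hOg, Subtype.image_preimage_coe]
  refine (euclideanHausdorffMeasure_faceSet K hs).2 O hO ⟨x.1, x.2, ?_⟩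
  have : x ∈ Function.support g := hx
  rw [← hOg] at this
  exact this

theorem mean_eq {s : Finset (Fin (n + 1))} {ℓ : ℕ} (g : faceSet K s → ℝ) :
    mean (faceSet K s) ℓ g =
      ((faceMeasure K s ℓ).real Set.univ)⁻¹ * ∫ x, g x ∂faceMeasure K s ℓ := by
  rw [mean, average_eq, smul_eq_mul]

theorem faceMeasure_real_univ_pos {s : Finset (Fin (n + 1))} {ℓ : ℕ} (hs : s.card = ℓ + 1) :
    0 < (faceMeasure K s ℓ).real Set.univ := by
  have := isFiniteMeasure_faceMeasure K hs
  rw [measureReal_def, ENNReal.toReal_pos_iff, faceMeasure_apply, Subtype.coe_image_univ]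
  obtain ⟨i, hi⟩ : s.Nonempty := Finset.card_pos.1 (by omega)
  have h := (euclideanHausdorffMeasure_faceSet K hs).2 Set.univ isOpen_univ
    ⟨K.points i, subset_convexHull ℝ _ ⟨i, hi, rfl⟩, trivial⟩
  rw [Set.inter_univ] at h
  exact ⟨h, (euclideanHausdorffMeasure_faceSet K hs).1⟩

/-- The mean of a polynomial over a subsimplex. -/
noncomputable def meanPoly {s : Finset (Fin (n + 1))} {ℓ : ℕ} (hs : s.card = ℓ + 1) :
    Poly n →ₗ[ℝ] ℝ where
  toFun p := mean (faceSet K s) ℓ fun x => pval p x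
  map_add' p q := by
    simp only [mean_eq, pval_add]
    rw [integral_add, mul_add] <;>
      exact integrable_faceMeasure K hs ((continuous_pval _).comp continuous_subtype_val)
  map_smul' c p := by
    simp only [mean_eq, pval_smul, integral_const_mul, RingHom.id_apply, smul_eq_mul]
    ring

theorem meanPoly_congr {s : Finset (Fin (n + 1))} {ℓ : ℕ} (hs : s.card = ℓ + 1) {p q : Poly n}
    (h : ∀ x ∈ faceSet K s, pval p x = pval q x) : meanPoly K hs p = meanPoly K hs q := by
  have : (fun x : faceSet K s => pval p x) = fun x : faceSet K s => pval q x :=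
    funext fun x => h x x.2
  change mean _ _ _ = mean _ _ _
  rw [this]

theorem eq_zero_of_meanPoly_eq_zero {s : Finset (Fin (n + 1))} {ℓ : ℕ} (hs : s.card = ℓ + 1)
    {p : Poly n} (h0 : ∀ x ∈ faceSet K s, 0 ≤ pval p x) (h : meanPoly K hs p = 0)
    {x : E n} (hx : x ∈ faceSet K s) : pval p x = 0 := by
  change mean _ _ _ = 0 at h
  rw [mean_eq] at h
  have h1 := (mul_eq_zero.1 h).resolve_left (inv_ne_zero (faceMeasure_real_univ_pos K hs).ne')
  exact eq_zero_of_integral_faceMeasure_eq_zero K hs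
    ((continuous_pval p).comp continuous_subtype_val) (fun y => h0 y y.2) h1 ⟨x, hx⟩

theorem bub_nonneg {s s' : Finset (Fin (n + 1))} {x : E n} (hx : x ∈ faceSet K s') :
    0 ≤ pval (bub K s) x := by
  rw [bub, pval_prod]
  refine Finset.prod_nonneg fun i _ => ?_
  rw [pval_lam]
  exact ((mem_faceSet_iff K s' x).1 hx).1 i

/-- A polynomial whose product with the bubble function vanishes on a subsimplex vanishes there:
it vanishes at the points with positive coordinates, which are dense. -/
theorem eq_zero_of_bub_mul_eq_zero {s : Finset (Fin (n + 1))} (hs : s.Nonempty) {p : Poly n}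
    (h : ∀ x ∈ faceSet K s, pval (bub K s * p) x = 0) {x : E n} (hx : x ∈ faceSet K s) :
    pval p x = 0 := by
  -- `w` are the barycentric coordinates of the centroid `y`; the segment from `y` to `x` has
  -- positive coordinates except possibly at `x`
  let w : Fin (n + 1) → ℝ := fun i => if i ∈ s then (s.card : ℝ)⁻¹ else 0
  have hc : (0 : ℝ) < s.card := by exact_mod_cast hs.card_pos
  have hw1 : ∑ i, w i = 1 := by
    simp only [w, Finset.sum_ite_mem, Finset.univ_inter, Finset.sum_const, nsmul_eq_mul]
    exact mul_inv_cancel₀ hc.ne'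
  let y : E n := Finset.univ.affineCombination ℝ (bary K) w
  have hy : ∀ i, (bary K).coord i y = w i := fun i =>
    (bary K).coord_apply_combination_of_mem (Finset.mem_univ i) hw1
  have hx' := (mem_faceSet_iff K s x).1 hx
  let f : ℝ → ℝ := fun r => pval p ((1 - r) • x + r • y)
  have hf : Continuous f := (continuous_pval p).comp (by fun_prop)
  have hco : ∀ i r, (bary K).coord i ((1 - r) • x + r • y)
      = (1 - r) * (bary K).coord i x + r * w i := fun i r => by
    rw [Convex.combo_affine_apply (by ring), hy]; rfl
  have hpos : ∀ r ∈ Set.Ioo (0 : ℝ) 1, f r = 0 := by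
    rintro r ⟨h0, h1⟩
    have hmem : (1 - r) • x + r • y ∈ faceSet K s := by
      rw [mem_faceSet_iff]
      refine ⟨fun i => ?_, fun i hi => ?_⟩
      · rw [hco]
        refine add_nonneg (mul_nonneg (by linarith) (hx'.1 i)) (mul_nonneg h0.le ?_)
        simp only [w]
        split_ifs
        · positivity
        · exact le_rfl
      · rw [hco, hx'.2 i hi]
        simp [w, hi]
    have h2 := h _ hmem
    rw [pval_mul, bub, pval_prod] at h2
    refine (mul_eq_zero.1 h2).resolve_left (Finset.prod_ne_zero_iff.2 fun i hi => ?_)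
    rw [pval_lam, hco]
    have h3 : w i = (s.card : ℝ)⁻¹ := if_pos hi
    have h4 : 0 ≤ (1 - r) * (bary K).coord i x := mul_nonneg (by linarith) (hx'.1 i)
    have h5 : 0 < r * w i := by rw [h3]; positivity
    linarith
  have hcl : IsClosed {r | f r = 0} := isClosed_singleton.preimage hf
  have h0 : (0 : ℝ) ∈ closure (Set.Ioo (0 : ℝ) 1) := by
    rw [closure_Ioo zero_ne_one]; simp
  have := hcl.closure_subset_iff.2 hpos h0
  simpa [f] using this

theorem eq_zero_of_pval_body_eq_zero {p : Poly n} (h : ∀ x ∈ body K, pval p x = 0) : p = 0 := by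
  obtain ⟨P, hP, rfl⟩ := exists_bern_eq K (le_refl p.totalDegree)
  have : P = 0 := by
    ext d
    exact coeff_eq_zero_of_vanish K Finset.univ_nonempty hP
      (fun x hx => h x (by rwa [faceSet_univ] at hx)) (Finset.subset_univ _)
  rw [this, map_zero]

theorem integrableOn_pval (p : Poly n) : IntegrableOn (pval p) (body K) :=
  (continuous_pval p).continuousOn.integrableOn_compact
    (by rw [← faceSet_univ]; exact isCompact_faceSet K _)

/-- The integral of a polynomial over `K`. -/
noncomputable def intK : Poly n →ₗ[ℝ] ℝ where
  toFun p := ∫ x in body K, pval p x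
  map_add' p q := by
    simp only [pval_add]
    exact integral_add (integrableOn_pval K p) (integrableOn_pval K q)
  map_smul' c p := by
    simp only [pval_smul, integral_const_mul, RingHom.id_apply, smul_eq_mul]

theorem eq_zero_of_intK_eq_zero {p : Poly n} (h0 : ∀ x ∈ body K, 0 ≤ pval p x)
    (h : intK K p = 0) : p = 0 := by
  refine eq_zero_of_pval_body_eq_zero K fun x hx => ?_
  have h1 : ∫ x : faceSet K Finset.univ, pval p x ∂faceMeasure K Finset.univ n = 0 := by
    rw [integral_subtype_comap (measurableSet_faceSet K _) (pval p),
      EuclideanSpace.euclideanHausdorffMeasure_eq_volume, faceSet_univ]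
    exact h
  exact eq_zero_of_integral_faceMeasure_eq_zero K (ℓ := n) (by simp)
    ((continuous_pval p).comp continuous_subtype_val)
    (fun y => h0 y (by rw [← faceSet_univ]; exact y.2)) h1 ⟨x, by rwa [faceSet_univ]⟩

theorem intK_nonneg {p : Poly n} (h0 : ∀ x ∈ body K, 0 ≤ pval p x) : 0 ≤ intK K p := by
  refine setIntegral_nonneg ?_ h0
  rw [← faceSet_univ]
  exact measurableSet_faceSet K _

theorem eq_zero_of_intK_sum_eq_zero {ι : Type*} {s : Finset ι} {p : ι → Poly n}
    (h0 : ∀ i ∈ s, ∀ x ∈ body K, 0 ≤ pval (p i) x) (h : intK K (∑ i ∈ s, p i) = 0) :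
    ∀ i ∈ s, p i = 0 := by
  rw [map_sum, Finset.sum_eq_zero_iff_of_nonneg fun i hi => intK_nonneg K (h0 i hi)] at h
  exact fun i hi => eq_zero_of_intK_eq_zero K (h0 i hi) (h i hi)

/-! ### Integration by parts along an edge -/

/-- The derivative of a polynomial in the direction `e`. -/
noncomputable def dirDeriv (e : Fin n → ℝ) (p : Poly n) : Poly n :=
  ∑ a, MvPolynomial.C (e a) * MvPolynomial.pderiv a p

theorem dirDeriv_mul (e : Fin n → ℝ) (p q : Poly n) :
    dirDeriv e (p * q) = dirDeriv e p * q + p * dirDeriv e q := by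
  simp only [dirDeriv, Derivation.leibniz, smul_eq_mul, Finset.sum_mul, Finset.mul_sum,
    ← Finset.sum_add_distrib]
  exact Finset.sum_congr rfl fun a _ => by ring

theorem hasDerivAt_pval_line (p : Poly n) (x e : E n) (r : ℝ) :
    HasDerivAt (fun s : ℝ => pval p (x + s • e)) (pval (dirDeriv e.ofLp p) (x + r • e)) r := by
  induction p using MvPolynomial.induction_on with
  | C a =>
    simp only [pval_C, dirDeriv, MvPolynomial.pderiv_C, mul_zero, Finset.sum_const_zero, pval_zero]
    exact hasDerivAt_const _ _
  | add p q hp hq =>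
    have : dirDeriv e.ofLp (p + q) = dirDeriv e.ofLp p + dirDeriv e.ofLp q := by
      simp [dirDeriv, mul_add, Finset.sum_add_distrib]
    simp only [this, pval_add]
    exact hp.add hq
  | mul_X p j hp =>
    have hX : dirDeriv e.ofLp (MvPolynomial.X j) = MvPolynomial.C (e j) := by
      simp [dirDeriv, MvPolynomial.pderiv_X, Pi.single_apply]
    rw [dirDeriv_mul, hX]
    simp only [pval_mul, pval_add, pval_X, pval_C, PiLp.add_apply, PiLp.smul_apply, smul_eq_mul]
    have h1 : HasDerivAt (fun s : ℝ => x j + s * e j) (e j) r := by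
      simpa using ((hasDerivAt_id r).mul_const (e j)).const_add (x j)
    exact hp.mul h1

theorem coord_line (k i j : Fin (n + 1)) (x : E n) (r : ℝ) :
    (bary K).coord k (x + r • WithLp.toLp 2 (edge K i j)) = (bary K).coord k x +
      r * ((if k = j then 1 else 0) - (if k = i then 1 else 0)) := by
  have h := ((bary K).coord k).map_vadd x (r • WithLp.toLp 2 (edge K i j))
  rw [map_smul, coord_linear_eq, vadd_eq_add, vadd_eq_add, add_comm _ x] at h
  rw [h, grad_dotProduct_edge, smul_eq_mul, add_comm]

/-- On each line parallel to an edge the fundamental theorem of calculus holds for the extension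
by zero of a polynomial that vanishes on the two facets not containing the edge. -/
theorem intervalIntegral_edge {i j : Fin (n + 1)} (hij : i ≠ j) (p : Poly n) (x : E n) :
    ∫ r in (0 : ℝ)..1, (body K).indicator
        (pval (dirDeriv (edge K i j) (lam K i * lam K j * p)))
          (x + r • WithLp.toLp 2 (edge K i j)) =
      (body K).indicator (pval (lam K i * lam K j * p)) (x + WithLp.toLp 2 (edge K i j)) -
        (body K).indicator (pval (lam K i * lam K j * p)) x := by
  set e : E n := WithLp.toLp 2 (edge K i j) with he
  have hci : ∀ r : ℝ, (bary K).coord i (x + r • e) = (bary K).coord i x - r := fun r => by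
    rw [coord_line, if_neg hij, if_pos rfl]; ring
  have hcj : ∀ r : ℝ, (bary K).coord j (x + r • e) = (bary K).coord j x + r := fun r => by
    rw [coord_line, if_pos rfl, if_neg hij.symm]; ring
  have hck : ∀ k, k ≠ i → k ≠ j → ∀ r : ℝ,
      (bary K).coord k (x + r • e) = (bary K).coord k x := fun k hi hj r => by
    rw [coord_line, if_neg hj, if_neg hi]; ring
  by_cases hA : ∀ k, k ≠ i → k ≠ j → 0 ≤ (bary K).coord k x
  · have hbody : ∀ r : ℝ, x + r • e ∈ body K ↔
        0 ≤ (bary K).coord i x - r ∧ 0 ≤ (bary K).coord j x + r := fun r => by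
      rw [body_eq, Set.mem_ofPred_eq]
      constructor
      · intro h
        exact ⟨hci r ▸ h i, hcj r ▸ h j⟩
      · rintro ⟨h1, h2⟩ k
        by_cases hki : k = i
        · rw [hki, hci]; exact h1
        by_cases hkj : k = j
        · rw [hkj, hcj]; exact h2
        rw [hck k hki hkj]
        exact hA k hki hkj
    -- on the line only `λᵢ` and `λⱼ` vary, so the extension by zero is this continuous function,
    -- differentiable except where `λᵢ` or `λⱼ` changes sign
    let f : ℝ → ℝ := fun r =>
      max ((bary K).coord i x - r) 0 * max ((bary K).coord j x + r) 0 * pval p (x + r • e)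
    have hf : ∀ r, f r = (body K).indicator (pval (lam K i * lam K j * p)) (x + r • e) := by
      intro r
      by_cases h : x + r • e ∈ body K
      · rw [Set.indicator_of_mem h]
        obtain ⟨h1, h2⟩ := (hbody r).1 h
        simp only [f, max_eq_left h1, max_eq_left h2, pval_mul, pval_lam, hci, hcj]
      · rw [Set.indicator_of_notMem h]
        rw [hbody, not_and_or, not_le, not_le] at h
        rcases h with h | h
        · simp [f, max_eq_right h.le]
        · simp [f, max_eq_right h.le]
    have hcont : Continuous f := by
      have := continuous_pval p
      fun_prop
    have hline : Continuous fun r : ℝ => x + r • e := by fun_prop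
    have hbm : MeasurableSet (body K) := by
      rw [← faceSet_univ]; exact measurableSet_faceSet K _
    have key := integral_eq_of_hasDerivAt_off_countable f
      (fun r => (body K).indicator
        (pval (dirDeriv (edge K i j) (lam K i * lam K j * p))) (x + r • e))
      (a := 0) (b := 1) (s := {(bary K).coord i x, -(bary K).coord j x})
      (Set.Finite.countable (by simp)) hcont.continuousOn ?_ ?_
    · rw [key, hf, hf, one_smul, zero_smul, add_zero]
    · rintro r ⟨-, hr⟩
      rw [Set.mem_insert_iff, Set.mem_singleton_iff, not_or] at hr
      have hr1 : (bary K).coord i x - r ≠ 0 := fun h => hr.1 (by linarith)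
      have hr2 : (bary K).coord j x + r ≠ 0 := fun h => hr.2 (by linarith)
      have c1 : Continuous fun r : ℝ => (bary K).coord i x - r := by fun_prop
      have c2 : Continuous fun r : ℝ => (bary K).coord j x + r := by fun_prop
      rcases lt_or_gt_of_ne hr1 with h1 | h1
      · rw [Set.indicator_of_notMem fun h => h1.not_ge ((hbody r).1 h).1]
        refine (hasDerivAt_const r (0 : ℝ)).congr_of_eventuallyEq ?_
        filter_upwards [c1.continuousAt.eventually_lt_const h1] with s hs
        simp [f, max_eq_right hs.le]
      rcases lt_or_gt_of_ne hr2 with h2 | h2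
      · rw [Set.indicator_of_notMem fun h => h2.not_ge ((hbody r).1 h).2]
        refine (hasDerivAt_const r (0 : ℝ)).congr_of_eventuallyEq ?_
        filter_upwards [c2.continuousAt.eventually_lt_const h2] with s hs
        simp [f, max_eq_right hs.le]
      · rw [Set.indicator_of_mem ((hbody r).2 ⟨h1.le, h2.le⟩)]
        refine (hasDerivAt_pval_line _ x e r).congr_of_eventuallyEq ?_
        filter_upwards [c1.continuousAt.eventually_const_lt h1,
          c2.continuousAt.eventually_const_lt h2] with s hs1 hs2
        rw [hf, Set.indicator_of_mem ((hbody s).2 ⟨hs1.le, hs2.le⟩)]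
    · rw [intervalIntegrable_iff]
      have : (fun r : ℝ => (body K).indicator
          (pval (dirDeriv (edge K i j) (lam K i * lam K j * p))) (x + r • e)) =
          ((fun r : ℝ => x + r • e) ⁻¹' body K).indicator
            (fun r => pval (dirDeriv (edge K i j) (lam K i * lam K j * p)) (x + r • e)) := rfl
      rw [this]
      refine IntegrableOn.indicator ?_ (hbm.preimage hline.measurable)
      exact ((continuous_pval _).comp hline).integrableOn_uIoc
  · have hbody : ∀ r : ℝ, x + r • e ∉ body K := fun r h => hA fun k hi hj => by
      rw [body_eq, Set.mem_ofPred_eq] at h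
      rw [← hck k hi hj r]
      exact h k
    have h0 := hbody 0
    have h1 := hbody 1
    rw [zero_smul, add_zero] at h0
    rw [one_smul] at h1
    rw [Set.indicator_of_notMem h0, Set.indicator_of_notMem h1]
    simp only [Set.indicator_of_notMem (hbody _), intervalIntegral.integral_zero, sub_zero]

/-- The divergence theorem along an edge: averaging the fundamental theorem of calculus over all
lines parallel to the edge leaves the difference of two translates, which integrates to zero. -/
theorem intK_dirDeriv_edge {i j : Fin (n + 1)} (hij : i ≠ j) (p : Poly n) :
    intK K (dirDeriv (edge K i j) (lam K i * lam K j * p)) = 0 := by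
  set e : E n := WithLp.toLp 2 (edge K i j) with he
  set F : E n → ℝ := (body K).indicator (pval (lam K i * lam K j * p)) with hF
  set g : E n → ℝ :=
    (body K).indicator (pval (dirDeriv (edge K i j) (lam K i * lam K j * p))) with hg
  have hbm : MeasurableSet (body K) := by
    rw [← faceSet_univ]; exact measurableSet_faceSet K _
  have hFi : Integrable F := (integrableOn_pval K _).integrable_indicator hbm
  have hgi : Integrable g := (integrableOn_pval K _).integrable_indicator hbm
  have hline : ∀ x, ∫ r in Set.Ioc (0 : ℝ) 1, g (x + r • e) = F (x + e) - F x := fun x => by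
    rw [← intervalIntegral.integral_of_le zero_le_one]
    exact intervalIntegral_edge K hij p x
  have hint : Integrable (Function.uncurry fun (r : ℝ) (x : E n) => g (x + r • e))
      ((volume.restrict (Set.Ioc (0 : ℝ) 1)).prod volume) := by
    have hmp : MeasurePreserving (fun q : ℝ × E n => (q.1, q.2 + q.1 • e))
        ((volume.restrict (Set.Ioc (0 : ℝ) 1)).prod volume)
        ((volume.restrict (Set.Ioc (0 : ℝ) 1)).prod volume) :=
      (MeasurePreserving.id _).skew_product (g := fun r x => x + r • e)
        (by fun_prop)
        (Filter.Eventually.of_forall fun r => map_add_right_eq_self volume (r • e))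
    exact hmp.integrable_comp_of_integrable (hgi.comp_snd _)
  have h1 : ∫ r in Set.Ioc (0 : ℝ) 1, ∫ x, g (x + r • e) = ∫ x, g x := by
    simp only [integral_add_right_eq_self]
    simp
  have h2 := integral_integral_swap hint
  rw [h1] at h2
  simp only [hline] at h2
  rw [integral_sub (hFi.comp_add_right e) hFi, integral_add_right_eq_self, sub_self] at h2
  rw [hg, integral_indicator hbm] at h2
  exact h2

/-! ### Degrees of polynomial fields -/

/-- Polynomials with monomials of degree in `D` only. -/
noncomputable abbrev degPoly (n : ℕ) (D : Set ℕ) : Submodule ℝ (Poly n) :=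
  MvPolynomial.restrictSupport ℝ {d : Fin n →₀ ℕ | d.degree ∈ D}

theorem mem_degPoly {D : Set ℕ} {p : Poly n} :
    p ∈ degPoly n D ↔ ∀ d ∈ p.support, d.degree ∈ D := by
  simp [MvPolynomial.mem_restrictSupport_iff, Set.subset_def]

theorem mem_degPoly_Iic {m : ℕ} {p : Poly n} : p ∈ degPoly n (Set.Iic m) ↔ p.totalDegree ≤ m := by
  rw [MvPolynomial.totalDegree, Finset.sup_le_iff, mem_degPoly]
  rfl

theorem degPoly_mono {D D' : Set ℕ} (h : D ⊆ D') : degPoly n D ≤ degPoly n D' :=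
  MvPolynomial.restrictSupport_mono ℝ fun _ hd => h hd

theorem pderiv_mem_degPoly {D D' : Set ℕ} (h : ∀ d, d + 1 ∈ D → d ∈ D') {p : Poly n}
    (hp : p ∈ degPoly n D) (j : Fin n) : MvPolynomial.pderiv j p ∈ degPoly n D' := by
  rw [mem_degPoly] at hp ⊢
  intro d hd
  rw [MvPolynomial.mem_support_iff, MvPolynomial.coeff_pderiv] at hd
  have := hp _ (MvPolynomial.mem_support_iff.2 (left_ne_zero_of_mul hd))
  refine h _ ?_
  simpa using this

theorem eq_zero_of_mem_degPoly {D D' : Set ℕ} (h : Disjoint D D') {p : Poly n}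
    (hp : p ∈ degPoly n D) (hp' : p ∈ degPoly n D') : p = 0 := by
  rw [mem_degPoly] at hp hp'
  rw [← MvPolynomial.support_eq_empty, Finset.eq_empty_iff_forall_notMem]
  exact fun d hd => Set.disjoint_left.1 h (hp d hd) (hp' d hd)

theorem totalDegree_pderiv_le {m : ℕ} {p : Poly n} (hp : p.totalDegree ≤ m) (j : Fin n) :
    (MvPolynomial.pderiv j p).totalDegree ≤ m - 1 := by
  rw [← mem_degPoly_Iic] at hp ⊢
  exact pderiv_mem_degPoly (D := Set.Iic m) (D' := Set.Iic (m - 1))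
    (fun d hd => Nat.le_sub_one_of_lt hd) hp j

/-- The part of a polynomial of degree at most `k`. -/
noncomputable def lowPart (k : ℕ) (p : Poly n) : Poly n :=
  ∑ d ∈ p.support with d.degree ≤ k, MvPolynomial.monomial d (p.coeff d)

theorem lowPart_mem (k : ℕ) (p : Poly n) : lowPart k p ∈ degPoly n (Set.Iic k) :=
  Submodule.sum_mem _ fun _ hd =>
    (MvPolynomial.monomial_mem_restrictSupport _).2 (Or.inl (Finset.mem_filter.1 hd).2)

theorem sub_lowPart_mem {k m : ℕ} {p : Poly n} (hp : p ∈ degPoly n (Set.Iic m)) :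
    p - lowPart k p ∈ degPoly n (Set.Icc (k + 1) m) := by
  have h : p - lowPart k p =
      ∑ d ∈ p.support with ¬ d.degree ≤ k, MvPolynomial.monomial d (p.coeff d) := by
    rw [sub_eq_iff_eq_add, lowPart, add_comm,
      Finset.sum_filter_add_sum_filter_not]
    exact p.as_sum
  rw [h]
  refine Submodule.sum_mem _ fun d hd => ?_
  obtain ⟨h1, h2⟩ := Finset.mem_filter.1 hd
  exact (MvPolynomial.monomial_mem_restrictSupport _).2
    (Or.inl ⟨Nat.lt_of_not_le h2, mem_degPoly.1 hp d h1⟩)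

theorem mem_PVec {m : ℕ} {v : VecField n} : v ∈ PVec n m ↔ ∀ i, (v i).totalDegree ≤ m := by
  simp [PVec, Submodule.mem_pi, MvPolynomial.mem_restrictTotalDegree]

theorem mem_PVec' {m : ℕ} {v : VecField n} :
    v ∈ PVec n m ↔ ∀ i, v i ∈ degPoly n (Set.Iic m) := by
  simp only [mem_PVec, mem_degPoly_Iic]

theorem PVec_mono {m m' : ℕ} (h : m ≤ m') : PVec n m ≤ PVec n m' := fun _ hv =>
  mem_PVec.2 fun i => (mem_PVec.1 hv i).trans h

theorem mem_PSym {m : ℕ} {τ : MatField n} :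
    τ ∈ PSym n m ↔ τ.IsSymm ∧ ∀ i j, (τ i j).totalDegree ≤ m := by
  simp only [← mem_degPoly_Iic]
  rfl

theorem divg_mem {D D' : Set ℕ} (h : ∀ d, d + 1 ∈ D → d ∈ D') {τ : MatField n}
    (hτ : ∀ i j, τ i j ∈ degPoly n D) (i : Fin n) : divg τ i ∈ degPoly n D' :=
  Submodule.sum_mem _ fun j _ => pderiv_mem_degPoly h (hτ i j) j

theorem divg_mem_PVec {m : ℕ} {τ : MatField n} (hτ : τ ∈ PSym n m) : divg τ ∈ PVec n (m - 1) :=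
  mem_PVec'.2 fun i => divg_mem (D := Set.Iic m) (D' := Set.Iic (m - 1))
    (fun _ hd => Nat.le_sub_one_of_lt hd)
    (fun i j => mem_degPoly_Iic.2 ((mem_PSym.1 hτ).2 i j)) i

/-- The enriched space consists of the symmetric fields of degree at most `k + n - 1` whose
divergence has degree at most `k - 1`. -/
theorem mem_PStar {k : ℕ} (hn : 1 ≤ n) (hk : 1 ≤ k) {τ : MatField n} :
    τ ∈ PStar n k ↔ τ ∈ PSym n (k + n - 1) ∧ divg τ ∈ PVec n (k - 1) := by
  constructor
  · intro h
    obtain ⟨σ, hσ, ρ, ⟨⟨hρs, hρ⟩, hρ0⟩, rfl⟩ := Submodule.mem_sup.1 h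
    refine ⟨add_mem ⟨hσ.1, fun i j => degPoly_mono (Set.Iic_subset_Iic.2 (by omega)) (hσ.2 i j)⟩
      ⟨hρs, fun i j => degPoly_mono (fun _ hd => hd.2) (hρ i j)⟩, ?_⟩
    rw [map_add, LinearMap.mem_ker.1 hρ0, add_zero]
    exact divg_mem_PVec hσ
  · rintro ⟨hτ, hdiv⟩
    let σ : MatField n := Matrix.of fun i j => lowPart k (τ i j)
    have hσ : σ ∈ PSym n k := by
      refine ⟨Matrix.IsSymm.ext fun i j => ?_, fun i j => lowPart_mem k _⟩
      simp only [σ, Matrix.of_apply, hτ.1.apply i j]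
    have hρ : ∀ i j, (τ - σ) i j ∈ degPoly n (Set.Icc (k + 1) (k + n - 1)) := fun i j =>
      sub_lowPart_mem (hτ.2 i j)
    refine Submodule.mem_sup.2 ⟨σ, hσ, τ - σ, ⟨⟨(symFields n).sub_mem hτ.1 hσ.1, hρ⟩, ?_⟩,
      add_sub_cancel _ _⟩
    -- `div (τ - σ)` has degree at most `k - 1`, but no terms of degree below `k`
    change divg (τ - σ) = 0
    funext i
    refine eq_zero_of_mem_degPoly (D := Set.Iic (k - 1)) (D' := Set.Ici k) ?_ ?_ ?_
    · rw [Set.disjoint_left]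
      intro d h1 h2
      rw [Set.mem_Iic] at h1
      rw [Set.mem_Ici] at h2
      omega
    · rw [map_sub]
      exact Submodule.sub_mem _ (mem_PVec'.1 hdiv i) (mem_PVec'.1 (divg_mem_PVec hσ) i)
    · exact divg_mem (D := Set.Icc (k + 1) (k + n - 1)) (fun d hd => by
        have := hd.1
        rw [Set.mem_Ici]
        omega) hρ i

/-! ### Infinitesimal rigid motions -/

theorem eq_C_of_pderiv_eq_zero {p : Poly n} (h : ∀ j, MvPolynomial.pderiv j p = 0) :
    p = MvPolynomial.C (p.coeff 0) := by
  ext d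
  rw [MvPolynomial.coeff_C]
  split_ifs with hd
  · rw [hd]
  · obtain ⟨j, hj⟩ := Finsupp.ne_iff.1 (Ne.symm hd)
    rw [Finsupp.zero_apply] at hj
    have h1 := congrArg (MvPolynomial.coeff (d - Finsupp.single j 1)) (h j)
    rw [MvPolynomial.coeff_pderiv, MvPolynomial.coeff_zero] at h1
    have h2 : d - Finsupp.single j 1 + Finsupp.single j 1 = d :=
      tsub_add_cancel_of_le (Finsupp.single_le_iff.2 (Nat.one_le_iff_ne_zero.2 hj))
    rw [h2] at h1
    refine (mul_eq_zero.1 h1).resolve_right ?_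
    positivity

theorem pderiv_comm (i j : Fin n) (p : Poly n) :
    MvPolynomial.pderiv i (MvPolynomial.pderiv j p)
      = MvPolynomial.pderiv j (MvPolynomial.pderiv i p) := by
  ext d
  simp only [MvPolynomial.coeff_pderiv]
  by_cases h : i = j
  · rw [h]
  · rw [add_right_comm]
    simp [h, Ne.symm h]
    ring

theorem symGrad_eq_zero_iff {v : VecField n} :
    symGrad v = 0 ↔ ∀ i j, MvPolynomial.pderiv j (v i) = -MvPolynomial.pderiv i (v j) := by
  rw [← Matrix.ext_iff]
  refine forall_congr' fun i => forall_congr' fun j => ?_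
  rw [← add_eq_zero_iff_eq_neg]
  simp only [symGrad, LinearMap.coe_mk, AddHom.coe_mk, Matrix.of_apply, Matrix.zero_apply]
  exact smul_eq_zero_iff_right (by norm_num)

/-- The infinitesimal rigid motion with translation part `a.1` and rotation part `a.2`, where a
skew-symmetric matrix is given by its entries above the diagonal. -/
noncomputable def rigid (n : ℕ) :
    ((Fin n → ℝ) × ({e : Fin n × Fin n // e.1 < e.2} → ℝ)) →ₗ[ℝ] VecField n where
  toFun a i := MvPolynomial.C (a.1 i) + ∑ e, a.2 e •
    ((if i = e.1.1 then MvPolynomial.X e.1.2 else 0) -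
      (if i = e.1.2 then MvPolynomial.X e.1.1 else 0))
  map_add' a b := by
    funext i
    simp only [Prod.fst_add, Prod.snd_add, Pi.add_apply, map_add, add_smul,
      Finset.sum_add_distrib]
    abel
  map_smul' c a := by
    funext i
    simp only [Prod.smul_fst, Prod.smul_snd, Pi.smul_apply, smul_eq_mul, map_mul, RingHom.id_apply,
      smul_add, Finset.smul_sum, mul_smul, MvPolynomial.smul_eq_C_mul]

theorem pderiv_rigid (a : (Fin n → ℝ) × ({e : Fin n × Fin n // e.1 < e.2} → ℝ)) (i j : Fin n) :
    MvPolynomial.pderiv j (rigid n a i) = MvPolynomial.C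
      ((if h : i < j then a.2 ⟨(i, j), h⟩ else 0) -
        (if h : j < i then a.2 ⟨(j, i), h⟩ else 0)) := by
  have h1 : ∀ (i j : Fin n), ∑ e : {e : Fin n × Fin n // e.1 < e.2},
      (if i = e.1.1 ∧ j = e.1.2 then a.2 e else 0) =
        if h : i < j then a.2 ⟨(i, j), h⟩ else 0 := by
    intro i j
    split_ifs with h
    · rw [Finset.sum_eq_single ⟨(i, j), h⟩]
      · simp
      · rintro ⟨⟨x, y⟩, hxy⟩ - hne
        refine if_neg ?_
        rintro ⟨rfl, rfl⟩
        exact hne rfl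
      · simp
    · refine Finset.sum_eq_zero ?_
      rintro ⟨⟨x, y⟩, hxy⟩ -
      refine if_neg ?_
      rintro ⟨rfl, rfl⟩
      exact h hxy
  rw [← h1, ← h1, ← Finset.sum_sub_distrib, map_sum]
  simp only [rigid, LinearMap.coe_mk, AddHom.coe_mk, map_add, MvPolynomial.pderiv_C, zero_add,
    map_sum, Derivation.map_smul, map_sub]
  refine Finset.sum_congr rfl fun e _ => ?_
  rw [MvPolynomial.smul_eq_C_mul, mul_sub]
  congr 1
  · by_cases h : i = e.1.1
    · by_cases h' : j = e.1.2
      · simp [h, h']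
      · simp [h, h', MvPolynomial.pderiv_X_of_ne (Ne.symm h')]
    · simp [h]
  · by_cases h : i = e.1.2
    · by_cases h' : j = e.1.1
      · simp [h, h']
      · simp [h, h', MvPolynomial.pderiv_X_of_ne (Ne.symm h')]
    · simp [h]

theorem rigid_injective : Function.Injective (rigid n) := by
  rw [← LinearMap.ker_eq_bot, LinearMap.ker_eq_bot']
  intro a ha
  have h2 : a.2 = 0 := by
    funext e
    have h := pderiv_rigid a e.1.1 e.1.2
    rw [ha, dif_pos e.2, dif_neg e.2.le.not_gt, sub_zero, Pi.zero_apply, map_zero] at h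
    exact (MvPolynomial.C_eq_zero.1 h.symm)
  have h1 : a.1 = 0 := by
    funext i
    have h := congrFun ha i
    simp only [rigid, h2, LinearMap.coe_mk, AddHom.coe_mk, Pi.zero_apply, zero_smul,
      Finset.sum_const_zero, add_zero] at h
    exact MvPolynomial.C_eq_zero.1 h
  exact Prod.ext h1 h2

/-- The kernel of the symmetric gradient: its first derivatives are skew, so its second
derivatives vanish. -/
theorem range_rigid : LinearMap.range (rigid n) = LinearMap.ker symGrad := by
  apply le_antisymm
  · rintro _ ⟨a, rfl⟩
    rw [LinearMap.mem_ker, symGrad_eq_zero_iff]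
    intro i j
    rw [pderiv_rigid, pderiv_rigid, ← map_neg, neg_sub]
  · intro v hv
    rw [LinearMap.mem_ker, symGrad_eq_zero_iff] at hv
    have h2 : ∀ i j k, MvPolynomial.pderiv k (MvPolynomial.pderiv j (v i)) = 0 := by
      intro i j k
      have h : MvPolynomial.pderiv k (MvPolynomial.pderiv j (v i)) =
          -MvPolynomial.pderiv k (MvPolynomial.pderiv j (v i)) := by
        conv_lhs => rw [hv i j, map_neg, pderiv_comm, hv j k, map_neg, neg_neg, pderiv_comm,
          hv k i, map_neg, pderiv_comm]
      exact self_eq_neg.1 h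
    choose A hA using fun i j => (⟨_, eq_C_of_pderiv_eq_zero (h2 i j)⟩ :
      ∃ c, MvPolynomial.pderiv j (v i) = MvPolynomial.C c)
    have hskew : ∀ i j, A i j = -A j i := fun i j => by
      have := hv i j
      rw [hA, hA, ← map_neg] at this
      exact MvPolynomial.C_injective _ _ this
    let b : {e : Fin n × Fin n // e.1 < e.2} → ℝ := fun e => A e.1.1 e.1.2
    have hb : ∀ i j, MvPolynomial.pderiv j (v i - rigid n (0, b) i) = 0 := by
      intro i j
      rw [map_sub, pderiv_rigid, hA, ← map_sub, MvPolynomial.C_eq_zero, sub_eq_zero]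
      rcases lt_trichotomy i j with h | h | h
      · rw [dif_pos h, dif_neg h.le.not_gt, sub_zero]
      · subst h
        have := hskew i i
        simp only [lt_self_iff_false, dite_false, sub_zero]
        linarith
      · rw [dif_neg h.le.not_gt, dif_pos h, zero_sub, hskew]
    refine ⟨(fun i => (v i - rigid n (0, b) i).coeff 0, b), ?_⟩
    funext i
    have h := eq_C_of_pderiv_eq_zero (hb i)
    rw [sub_eq_iff_eq_add] at h
    rw [h]
    simp [rigid]

theorem rigid_mem_PVec (a : (Fin n → ℝ) × ({e : Fin n × Fin n // e.1 < e.2} → ℝ)) {m : ℕ}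
    (hm : 1 ≤ m) : rigid n a ∈ PVec n m := by
  rw [mem_PVec]
  intro i
  refine (MvPolynomial.totalDegree_add _ _).trans (max_le (by simp) ?_)
  refine MvPolynomial.totalDegree_finsetSum_le fun e _ => ?_
  refine (MvPolynomial.totalDegree_smul_le _ _).trans ((MvPolynomial.totalDegree_sub _ _).trans ?_)
  refine max_le ?_ ?_ <;> split_ifs <;> simp [hm]

theorem card_lt_pairs (r : ℕ) : Fintype.card {e : Fin r × Fin r // e.1 < e.2} = r.choose 2 := by
  let f : {e : Fin r × Fin r // e.1 < e.2} ≃ Σ j : Fin r, Fin j :=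
    { toFun := fun e => ⟨e.1.2, ⟨e.1.1, e.2⟩⟩
      invFun := fun a => ⟨(⟨a.2, a.2.2.trans a.1.2⟩, a.1), a.2.2⟩
      left_inv := fun _ => rfl
      right_inv := fun _ => rfl }
  rw [Fintype.card_congr f, Fintype.card_sigma]
  simp only [Fintype.card_fin]
  rw [Fin.sum_univ_eq_sum_range (fun i => i) r, Finset.sum_range_id, Nat.choose_two_right]

theorem ker_symGrad_le_PVec {m : ℕ} (hm : 1 ≤ m) : LinearMap.ker symGrad ≤ PVec n m := by
  rw [← range_rigid]
  rintro _ ⟨a, rfl⟩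
  exact rigid_mem_PVec a hm

theorem finrank_ker_symGrad :
    Module.finrank ℝ (LinearMap.ker (symGrad (n := n))) = (n + 1).choose 2 := by
  rw [← range_rigid, LinearMap.finrank_range_of_inj rigid_injective, Module.finrank_prod,
    Module.finrank_fintype_fun_eq_card, Module.finrank_fintype_fun_eq_card, card_lt_pairs,
    Fintype.card_fin, Nat.choose_succ_succ' n 1, Nat.choose_one_right]

/-! ### Edge decomposition of symmetric fields -/

/-- The edges of an `n`-simplex. -/
abbrev Edge (n : ℕ) : Type := {e : Fin (n + 1) × Fin (n + 1) // e.1 < e.2}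

/-- The tangent vector of an edge. -/
noncomputable abbrev tvec (e : Edge n) : Fin n → ℝ := edge K e.1.1 e.1.2

/-- The field `∑ₑ qₑ tₑ tₑᵀ` with coefficients `qₑ` along the edges `e`. -/
noncomputable def edgeField : (Edge n → Poly n) →ₗ[ℝ] MatField n where
  toFun q := Matrix.of fun a b => ∑ e, MvPolynomial.C (tvec K e a * tvec K e b) * q e
  map_add' p q := by
    ext1 a b
    simp [mul_add, Finset.sum_add_distrib]
  map_smul' c p := by
    ext1 a b
    simp [Finset.smul_sum]

theorem edgeField_apply (q : Edge n → Poly n) (a b : Fin n) :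
    edgeField K q a b = ∑ e, MvPolynomial.C (tvec K e a * tvec K e b) * q e := rfl

theorem isSymm_edgeField (q : Edge n → Poly n) : (edgeField K q).IsSymm :=
  Matrix.IsSymm.ext fun a b => by simp only [edgeField_apply, mul_comm]

/-- The component `uᵀ τ w` of a matrix field. -/
noncomputable def pairing (u w : Fin n → ℝ) : MatField n →ₗ[ℝ] Poly n where
  toFun τ := ∑ a, ∑ b, MvPolynomial.C (u a * w b) * τ a b
  map_add' σ τ := by simp [mul_add, Finset.sum_add_distrib]
  map_smul' c τ := by simp [Finset.smul_sum]

theorem pairing_apply (u w : Fin n → ℝ) (τ : MatField n) :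
    pairing u w τ = ∑ a, ∑ b, MvPolynomial.C (u a * w b) * τ a b := rfl

theorem pval_pairing (u w : Fin n → ℝ) (τ : MatField n) (x : E n) :
    pval (pairing u w τ) x = dotProduct u ((mval τ x).mulVec w) := by
  simp only [pairing_apply, pval_sum, pval_mul, pval_C, dotProduct, Matrix.mulVec, mval,
    Matrix.of_apply, Finset.mul_sum]
  refine Finset.sum_congr rfl fun a _ => Finset.sum_congr rfl fun b _ => ?_
  ring

theorem totalDegree_pairing_le {m : ℕ} {τ : MatField n} (hτ : τ ∈ PSym n m) (u w : Fin n → ℝ) :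
    (pairing u w τ).totalDegree ≤ m := by
  refine MvPolynomial.totalDegree_finsetSum_le fun a _ =>
    MvPolynomial.totalDegree_finsetSum_le fun b _ => ?_
  refine (MvPolynomial.totalDegree_mul _ _).trans ?_
  rw [MvPolynomial.totalDegree_C, zero_add]
  exact (mem_PSym.1 hτ).2 a b

theorem pairing_comm {τ : MatField n} (hτ : τ.IsSymm) (u w : Fin n → ℝ) :
    pairing u w τ = pairing w u τ := by
  rw [pairing_apply, pairing_apply, Finset.sum_comm]
  refine Finset.sum_congr rfl fun a _ => Finset.sum_congr rfl fun b _ => ?_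
  rw [hτ.apply a b, mul_comm (u b)]

/-- The component `∇λᵢᵀ τ ∇λⱼ` of a field. -/
noncomputable abbrev quad (i j : Fin (n + 1)) (τ : MatField n) : Poly n :=
  pairing (grad K i) (grad K j) τ

/-- The functionals `-∇λᵢᵀ · ∇λⱼ` with `i < j` are dual to the matrices `tᵢⱼ tᵢⱼᵀ`. -/
theorem quad_edgeField (e : Edge n) (q : Edge n → Poly n) :
    quad K e.1.1 e.1.2 (edgeField K q) = -q e := by
  have h : quad K e.1.1 e.1.2 (edgeField K q) = ∑ e', MvPolynomial.C
      (dotProduct (grad K e.1.1) (tvec K e') * dotProduct (grad K e.1.2) (tvec K e')) * q e' := by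
    have h' : ∀ e' : Edge n, MvPolynomial.C
        (dotProduct (grad K e.1.1) (tvec K e') * dotProduct (grad K e.1.2) (tvec K e')) * q e' =
        ∑ a, ∑ b, MvPolynomial.C
          (grad K e.1.1 a * tvec K e' a * (grad K e.1.2 b * tvec K e' b)) * q e' := by
      intro e'
      rw [dotProduct, dotProduct, Finset.sum_mul_sum]
      simp only [map_sum, Finset.sum_mul]
    simp only [h', quad, pairing_apply, edgeField_apply, Finset.mul_sum]
    conv_rhs => rw [Finset.sum_comm]
    refine Finset.sum_congr rfl fun a _ => ?_
    rw [Finset.sum_comm]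
    refine Finset.sum_congr rfl fun e' _ => Finset.sum_congr rfl fun b _ => ?_
    rw [← mul_assoc, ← map_mul]
    congr 2
    ring
  rw [h, Finset.sum_eq_single e]
  · obtain ⟨⟨i, j⟩, hij⟩ := e
    rw [grad_dotProduct_edge, grad_dotProduct_edge]
    simp [hij.ne, hij.ne']
  · rintro ⟨⟨k, l⟩, hkl⟩ - hne
    obtain ⟨⟨i, j⟩, hij⟩ := e
    simp only at hij hkl
    rw [grad_dotProduct_edge, grad_dotProduct_edge]
    have h0 : ((if i = l then 1 else 0) - (if i = k then 1 else 0) : ℝ) *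
        ((if j = l then 1 else 0) - (if j = k then 1 else 0)) = 0 := by
      by_cases h1 : i = l
      · have h2 : j ≠ l := by omega
        have h3 : j ≠ k := by omega
        simp [h2, h3]
      by_cases h2 : i = k
      · have h3 : j ≠ l := fun h => hne (by subst h h2; rfl)
        have h4 : j ≠ k := by omega
        simp [h3, h4]
      · simp [h1, h2]
    simp only [h0, map_zero, zero_mul]
  · simp

theorem sum_quad (i : Fin (n + 1)) (τ : MatField n) : ∑ j, quad K i j τ = 0 := by
  simp only [quad, pairing_apply]
  rw [Finset.sum_comm]
  refine Finset.sum_eq_zero fun a _ => ?_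
  rw [Finset.sum_comm]
  refine Finset.sum_eq_zero fun b _ => ?_
  rw [← Finset.sum_mul, ← map_sum, ← Finset.mul_sum]
  have := congrFun (sum_grad K) b
  rw [Finset.sum_apply] at this
  rw [this]
  simp

theorem sum_points_mul_grad (a b : Fin n) :
    ∑ i, K.points i a * grad K i b = if a = b then 1 else 0 := by
  have h := congrArg (MvPolynomial.pderiv b) (X_eq_sum_lam K a)
  rw [map_sum] at h
  simp only [MvPolynomial.pderiv_C_mul, pderiv_lam, ← map_mul, ← map_sum] at h
  rw [MvPolynomial.pderiv_X, Pi.single_apply] at h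
  refine MvPolynomial.C_injective (Fin n) ℝ ?_
  rw [← h]
  split_ifs <;> simp

/-- A field is recovered from its components by `τ = ∑ᵢⱼ (∇λᵢᵀ τ ∇λⱼ) vᵢ vⱼᵀ` with the vertices
`vᵢ`, since `∑ᵢ vᵢ ∇λᵢᵀ` is the identity matrix. -/
theorem sum_sum_quad (τ : MatField n) (a b : Fin n) :
    ∑ i, ∑ j, MvPolynomial.C (K.points i a * K.points j b) * quad K i j τ = τ a b := by
  have h : ∀ c d, ∑ i, ∑ j, MvPolynomial.C (K.points i a * K.points j b) *
      (MvPolynomial.C (grad K i c * grad K j d) * τ c d) =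
        MvPolynomial.C ((if a = c then 1 else 0) * (if b = d then 1 else 0)) * τ c d := by
    intro c d
    rw [← sum_points_mul_grad K, ← sum_points_mul_grad K, Finset.sum_mul_sum]
    simp only [map_sum, Finset.sum_mul]
    refine Finset.sum_congr rfl fun i _ => Finset.sum_congr rfl fun j _ => ?_
    rw [← mul_assoc, ← map_mul]
    congr 2
    ring
  calc _ = ∑ c, ∑ d, ∑ i, ∑ j, MvPolynomial.C (K.points i a * K.points j b) *
      (MvPolynomial.C (grad K i c * grad K j d) * τ c d) := by
        simp only [quad, pairing_apply, Finset.mul_sum]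
        simp only [Finset.sum_comm (s := (Finset.univ : Finset (Fin (n + 1))))
          (t := (Finset.univ : Finset (Fin n)))]
    _ = _ := by
        simp only [h]
        rw [Finset.sum_eq_single a, Finset.sum_eq_single b]
        · simp
        · intro d _ hd
          simp [Ne.symm hd]
        · simp
        · intro c _ hc
          simp [Ne.symm hc]
        · simp

/-- The components with `i < j` determine a symmetric field: those with `i = j` follow from
`∑ⱼ ∇λⱼ = 0`. -/
theorem eq_zero_of_quad_eq_zero {τ : MatField n} (hτ : τ.IsSymm)
    (h : ∀ e : Edge n, quad K e.1.1 e.1.2 τ = 0) : τ = 0 := by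
  have h1 : ∀ i j, i ≠ j → quad K i j τ = 0 := fun i j hij => by
    rcases lt_or_gt_of_ne hij with h' | h'
    · exact h ⟨(i, j), h'⟩
    · rw [quad, pairing_comm hτ]
      exact h ⟨(j, i), h'⟩
  have h2 : ∀ i j, quad K i j τ = 0 := fun i j => by
    by_cases hij : i = j
    · subst hij
      have := sum_quad K i τ
      rwa [Finset.sum_eq_single i (fun j _ hj => h1 i j (Ne.symm hj)) (by simp)] at this
    · exact h1 i j hij
  ext1 a b
  rw [← sum_sum_quad K τ a b]
  simp [h2]

theorem edgeField_quad {τ : MatField n} (hτ : τ.IsSymm) :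
    edgeField K (fun e => -quad K e.1.1 e.1.2 τ) = τ := by
  rw [← sub_eq_zero]
  refine eq_zero_of_quad_eq_zero K ((isSymm_edgeField K _).sub hτ) fun e => ?_
  rw [quad, map_sub, ← quad, ← quad, quad_edgeField, neg_neg, sub_self]

/-! ### Bubble fields -/

/-- The bubble field `∑ λᵢ λⱼ qᵢⱼ tᵢⱼ tᵢⱼᵀ`, the sum running over the edges `ij`. -/
noncomputable def bubbleField : (Edge n → Poly n) →ₗ[ℝ] MatField n :=
  (edgeField K).comp (LinearMap.pi fun e =>
    (LinearMap.mulLeft ℝ (lam K e.1.1 * lam K e.1.2)).comp (LinearMap.proj e))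

theorem bubbleField_eq (q : Edge n → Poly n) :
    bubbleField K q = edgeField K fun e => lam K e.1.1 * lam K e.1.2 * q e := rfl

theorem lam_ne_zero (i : Fin (n + 1)) : lam K i ≠ 0 := by
  intro h
  have h1 := pval_lam K i (K.points i)
  rw [h, pval_zero, ← bary_apply, (bary K).coord_apply_eq] at h1
  exact zero_ne_one h1

theorem bubbleField_injective : Function.Injective (bubbleField K) := by
  rw [← LinearMap.ker_eq_bot, LinearMap.ker_eq_bot']
  intro q hq
  funext e
  have h := quad_edgeField K e fun e => lam K e.1.1 * lam K e.1.2 * q e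
  rw [← bubbleField_eq, hq] at h
  rw [quad, map_zero, zero_eq_neg] at h
  exact (mul_eq_zero.1 h).resolve_left (mul_ne_zero (lam_ne_zero K _) (lam_ne_zero K _))

theorem bubbleField_mem_PSym {r : ℕ} {q : Edge n → Poly n} (hq : ∀ e, (q e).totalDegree ≤ r) :
    bubbleField K q ∈ PSym n (r + 2) := by
  rw [mem_PSym]
  refine ⟨isSymm_edgeField K _, fun a b => ?_⟩
  rw [bubbleField_eq, edgeField_apply]
  refine MvPolynomial.totalDegree_finsetSum_le fun e _ => ?_
  refine (MvPolynomial.totalDegree_mul _ _).trans ?_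
  rw [MvPolynomial.totalDegree_C, zero_add]
  refine (MvPolynomial.totalDegree_mul _ _).trans ?_
  have h1 := MvPolynomial.totalDegree_mul (lam K e.1.1) (lam K e.1.2)
  have h2 := totalDegree_lam_le K e.1.1
  have h3 := totalDegree_lam_le K e.1.2
  have h4 := hq e
  omega

theorem mulVec_eq_zero_iff {τ : MatField n} {x : E n} {ν : Fin n → ℝ} :
    (mval τ x).mulVec ν = 0 ↔ ∀ a, ∑ b, pval (τ a b) x * ν b = 0 := by
  rw [funext_iff]
  rfl

/-- Bubble fields annihilate the normals of each subsimplex there: a term survives at a point of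
the subsimplex only if its edge belongs to the subsimplex, and then the edge is tangential. -/
theorem bubbleField_mulVec_eq_zero (q : Edge n → Poly n) {s : Finset (Fin (n + 1))} {x : E n}
    (hx : x ∈ faceSet K s) {ν : E n} (hν : ν ∈ normals K s) :
    (mval (bubbleField K q) x).mulVec ν.ofLp = 0 := by
  rw [mulVec_eq_zero_iff]
  intro a
  simp only [bubbleField_eq, edgeField_apply, pval_sum, Finset.sum_mul]
  rw [Finset.sum_comm]
  refine Finset.sum_eq_zero fun e _ => ?_
  have hx' := (mem_faceSet_iff K s x).1 hx
  simp only [pval_mul, pval_C, pval_lam]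
  by_cases h1 : e.1.1 ∈ s
  · by_cases h2 : e.1.2 ∈ s
    · have h := edge_dotProduct_of_mem_normals K h1 h2 hν
      rw [dotProduct] at h
      rw [← mul_zero (tvec K e a *
        ((bary K).coord e.1.1 x * (bary K).coord e.1.2 x * pval (q e) x)), ← h, Finset.mul_sum]
      refine Finset.sum_congr rfl fun b _ => ?_
      ring
    · simp [hx'.2 _ h2]
  · simp [hx'.2 _ h1]

/-- Symmetric fields with vanishing normal components on the facets are bubble fields. -/
theorem exists_bubbleField_eq {r : ℕ} {τ : MatField n} (hτ : τ ∈ PSym n (r + 2))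
    (h : ∀ i : Fin (n + 1), ∀ x ∈ faceSet K {i}ᶜ, ∀ ν ∈ normals K {i}ᶜ,
      (mval τ x).mulVec ν.ofLp = 0) :
    ∃ q : Edge n → Poly n, (∀ e, (q e).totalDegree ≤ r) ∧ bubbleField K q = τ := by
  have hsymm := (mem_PSym.1 hτ).1
  have hcompl : ∀ i : Fin (n + 1), (Finset.univ : Finset (Fin (n + 1))).erase i = {i}ᶜ :=
    fun i => (Finset.compl_singleton i).symm
  have h2 : ∀ i j, ∀ x ∈ faceSet K (Finset.univ.erase j), pval (quad K i j τ) x = 0 := by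
    intro i j x hx
    rw [hcompl] at hx
    rw [pval_pairing, h j x hx (WithLp.toLp 2 (grad K j)) (grad_mem_normals K (by simp)),
      dotProduct_zero]
  have h1 : ∀ i j, ∀ x ∈ faceSet K (Finset.univ.erase i), pval (quad K i j τ) x = 0 := by
    intro i j x hx
    rw [quad, pairing_comm hsymm]
    exact h2 j i x hx
  have h3 : ∀ e : Edge n, ∃ q : Poly n, q.totalDegree ≤ r ∧
      -quad K e.1.1 e.1.2 τ = lam K e.1.1 * lam K e.1.2 * q := by
    intro e
    obtain ⟨q, hq, hqe⟩ := exists_eq_bub_mul K (m := r + 2) (by omega)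
      (s := {e.1.1, e.1.2}) (f := Finset.univ)
      (totalDegree_pairing_le hτ (grad K e.1.1) (grad K e.1.2)) (by
        intro i hi x hx
        rw [Finset.mem_insert, Finset.mem_singleton] at hi
        rcases hi with rfl | rfl
        · exact h1 _ _ x hx
        · exact h2 _ _ x hx)
    rw [Finset.card_pair e.2.ne] at hq
    refine ⟨-q, by rw [MvPolynomial.totalDegree_neg]; exact hq, ?_⟩
    rw [mul_neg, neg_inj, ← sub_eq_zero]
    refine eq_zero_of_pval_body_eq_zero K fun x hx => ?_
    rw [← faceSet_univ] at hx
    rw [pval_sub, hqe x hx, bub, Finset.prod_pair e.2.ne, sub_self]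
  choose q hq hqe using h3
  refine ⟨q, hq, ?_⟩
  rw [bubbleField_eq]
  simp only [← hqe]
  exact edgeField_quad K hsymm

/-! ### Integration by parts and the divergence of bubble fields -/

/-- The pointwise Frobenius product of matrix fields. -/
noncomputable def dotM (σ τ : MatField n) : Poly n := ∑ a, ∑ b, σ a b * τ a b

/-- The pointwise inner product of vector fields. -/
noncomputable def dotV (u v : VecField n) : Poly n := ∑ a, u a * v a

theorem inner2_eq (σ τ : MatField n) : inner2 K σ τ = intK K (dotM σ τ) := by
  simp only [inner2, intK, LinearMap.coe_mk, AddHom.coe_mk, dotM, pval_sum, pval_mul, mval,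
    Matrix.of_apply]

/-- The `L²` product of vector fields on `K`. -/
noncomputable def formV : LinearMap.BilinForm ℝ (VecField n) :=
  LinearMap.mk₂ ℝ (fun u v => intK K (dotV u v))
    (fun u v w => by simp [dotV, add_mul, Finset.sum_add_distrib])
    (fun c u v => by simp [dotV, ← Finset.smul_sum])
    (fun u v w => by simp [dotV, mul_add, Finset.sum_add_distrib])
    (fun c u v => by simp [dotV, ← Finset.smul_sum])

/-- The `L²` product of matrix fields on `K`. -/
noncomputable def formM : LinearMap.BilinForm ℝ (MatField n) :=
  LinearMap.mk₂ ℝ (fun u v => intK K (dotM u v))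
    (fun u v w => by simp [dotM, add_mul, Finset.sum_add_distrib])
    (fun c u v => by simp [dotM, ← Finset.smul_sum])
    (fun u v w => by simp [dotM, mul_add, Finset.sum_add_distrib])
    (fun c u v => by simp [dotM, ← Finset.smul_sum])

theorem formV_apply (u v : VecField n) : formV K u v = intK K (dotV u v) := rfl

theorem formM_apply (u v : MatField n) : formM K u v = intK K (dotM u v) := rfl

theorem formV_comm (u v : VecField n) : formV K u v = formV K v u := by
  simp only [formV_apply, dotV, mul_comm]

theorem pval_mul_self_nonneg (p : Poly n) (x : E n) : 0 ≤ pval (p * p) x := by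
  rw [pval_mul]
  exact mul_self_nonneg _

theorem eq_zero_of_formV_eq_zero {v : VecField n} (h : formV K v v = 0) : v = 0 := by
  funext a
  exact mul_self_eq_zero.1 (eq_zero_of_intK_sum_eq_zero K
    (fun a _ x _ => pval_mul_self_nonneg (v a) x) h a (Finset.mem_univ a))

theorem eq_zero_of_formM_eq_zero {τ : MatField n} (h : formM K τ τ = 0) : τ = 0 := by
  rw [formM_apply, dotM, ← Finset.sum_product'] at h
  ext1 a b
  exact mul_self_eq_zero.1 (eq_zero_of_intK_sum_eq_zero K
    (p := fun c : Fin n × Fin n => τ c.1 c.2 * τ c.1 c.2)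
    (fun c _ x _ => pval_mul_self_nonneg (τ c.1 c.2) x) h (a, b)
      (Finset.mem_product.2 ⟨Finset.mem_univ a, Finset.mem_univ b⟩))

/-- The component `tₑᵀ σ tₑ` of a field. -/
noncomputable abbrev tang (e : Edge n) (σ : MatField n) : Poly n :=
  pairing (tvec K e) (tvec K e) σ

theorem dotM_edgeField (q : Edge n → Poly n) (σ : MatField n) :
    dotM (edgeField K q) σ = ∑ e, q e * tang K e σ := by
  simp only [dotM, edgeField_apply, tang, pairing_apply, Finset.mul_sum, Finset.sum_mul]
  rw [Finset.sum_comm]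
  conv_rhs => rw [Finset.sum_comm]
  conv_lhs => rw [Finset.sum_comm]
  refine Finset.sum_congr rfl fun a _ => ?_
  rw [Finset.sum_comm]
  refine Finset.sum_congr rfl fun e _ => Finset.sum_congr rfl fun b _ => ?_
  ring

theorem isSymm_symGrad (v : VecField n) : (symGrad v).IsSymm :=
  Matrix.IsSymm.ext fun i j => by simp [symGrad, add_comm]

theorem dotM_symGrad {τ : MatField n} (hτ : τ.IsSymm) (v : VecField n) :
    dotM τ (symGrad v) = ∑ a, ∑ b, τ a b * MvPolynomial.pderiv b (v a) := by
  have h1 : dotM τ (symGrad v) = (1 / 2 : ℝ) • (∑ a, ∑ b, τ a b * MvPolynomial.pderiv b (v a) +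
      ∑ a, ∑ b, τ a b * MvPolynomial.pderiv a (v b)) := by
    simp only [dotM, symGrad, LinearMap.coe_mk, AddHom.coe_mk, Matrix.of_apply,
      ← Finset.sum_add_distrib, Finset.smul_sum, ← mul_add, mul_smul_comm]
  have h2 : ∑ a, ∑ b, τ a b * MvPolynomial.pderiv a (v b) =
      ∑ a, ∑ b, τ a b * MvPolynomial.pderiv b (v a) := by
    rw [Finset.sum_comm]
    refine Finset.sum_congr rfl fun a _ => Finset.sum_congr rfl fun b _ => ?_
    rw [hτ.apply a b]
  rw [h1, h2, ← two_smul ℝ, smul_smul]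
  norm_num

/-- Green's formula for bubble fields. -/
theorem formM_bubbleField_symGrad (q : Edge n → Poly n) (v : VecField n) :
    formM K (bubbleField K q) (symGrad v) = -formV K (divg (bubbleField K q)) v := by
  have h : dotM (bubbleField K q) (symGrad v) + dotV (divg (bubbleField K q)) v =
      ∑ e : Edge n, dirDeriv (edge K e.1.1 e.1.2) (lam K e.1.1 * lam K e.1.2 *
        (q e * ∑ a, MvPolynomial.C (tvec K e a) * v a)) := by
    rw [dotM_symGrad (τ := bubbleField K q) (isSymm_edgeField K _), dotV, ← Finset.sum_add_distrib]
    have h1 : ∀ a, ∑ b, bubbleField K q a b * MvPolynomial.pderiv b (v a) +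
        divg (bubbleField K q) a * v a =
          ∑ b, MvPolynomial.pderiv b (bubbleField K q a b * v a) := by
      intro a
      simp only [divg, LinearMap.coe_mk, AddHom.coe_mk, Finset.sum_mul, ← Finset.sum_add_distrib,
        Derivation.leibniz, smul_eq_mul]
      refine Finset.sum_congr rfl fun b _ => ?_
      ring
    simp only [h1]
    simp only [dirDeriv, bubbleField_eq, edgeField_apply, Finset.sum_mul, Finset.mul_sum,
      map_sum]
    conv_rhs => rw [Finset.sum_comm]
    rw [Finset.sum_comm]
    refine Finset.sum_congr rfl fun b _ => ?_
    rw [Finset.sum_comm]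
    refine Finset.sum_congr rfl fun e _ => Finset.sum_congr rfl fun a _ => ?_
    rw [← MvPolynomial.pderiv_C_mul]
    congr 1
    rw [map_mul]
    ring
  rw [eq_neg_iff_add_eq_zero, formM_apply, formV_apply, ← map_add, h, map_sum]
  exact Finset.sum_eq_zero fun e _ => intK_dirDeriv_edge K e.2.ne _

/-- A vector field that is orthogonal to the divergences of all bubble fields is a rigid motion:
test with the bubble field whose coefficients are the tangential components of `ε(v)`. -/
theorem symGrad_eq_zero_of_orthogonal {r : ℕ} {v : VecField n} (hv : v ∈ PVec n (r + 1))
    (h : ∀ q : Edge n → Poly n, (∀ e, (q e).totalDegree ≤ r) →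
      formV K (divg (bubbleField K q)) v = 0) : symGrad v = 0 := by
  have hdeg : ∀ e, (tang K e (symGrad v)).totalDegree ≤ r := by
    intro e
    refine totalDegree_pairing_le (mem_PSym.2 ⟨isSymm_symGrad v, fun a b => ?_⟩) _ _
    refine (MvPolynomial.totalDegree_smul_le _ _).trans
      ((MvPolynomial.totalDegree_add _ _).trans (max_le ?_ ?_))
    · exact totalDegree_pderiv_le (mem_PVec.1 hv a) b
    · exact totalDegree_pderiv_le (mem_PVec.1 hv b) a
  have h1 := h _ hdeg
  have h2 := formM_bubbleField_symGrad K (fun e => tang K e (symGrad v)) v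
  rw [h1, neg_zero, formM_apply, bubbleField_eq, dotM_edgeField] at h2
  have h3 : ∀ e, tang K e (symGrad v) = 0 := by
    intro e
    have := eq_zero_of_intK_sum_eq_zero K (fun e _ x hx => ?_) h2 e (Finset.mem_univ e)
    · rw [mul_assoc, mul_eq_zero, mul_self_eq_zero] at this
      exact this.resolve_left (mul_ne_zero (lam_ne_zero K _) (lam_ne_zero K _))
    · rw [body_eq, Set.mem_ofPred_eq] at hx
      rw [mul_assoc, pval_mul, pval_mul, pval_lam, pval_lam]
      exact mul_nonneg (mul_nonneg (hx _) (hx _)) (pval_mul_self_nonneg _ x)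
  -- the matrices `tₑ tₑᵀ` span the symmetric matrices, so `ε(v)` is orthogonal to itself
  refine eq_zero_of_formM_eq_zero K ?_
  rw [formM_apply]
  nth_rewrite 1 [← edgeField_quad K (isSymm_symGrad v)]
  rw [dotM_edgeField]
  simp [h3]

/-! ### Frames of tangent and normal vectors -/

theorem disjoint_tangents_normals (s : Finset (Fin (n + 1))) :
    Disjoint (tangents K s) (normals K s) :=
  Submodule.orthogonal_disjoint _

theorem linearIndependent_frame {s : Finset (Fin (n + 1))} {ℓ : ℕ} {t : Fin ℓ → E n}
    {ν : Fin (n - ℓ) → E n} (ht : LinearIndependent ℝ t ∧ ∀ l, t l ∈ tangents K s)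
    (hν : LinearIndependent ℝ ν ∧ ∀ i, ν i ∈ normals K s) :
    LinearIndependent ℝ (Sum.elim t ν) := by
  refine ht.1.sum_type hν.1 ((disjoint_tangents_normals K s).mono ?_ ?_)
  · rw [Submodule.span_le]
    rintro _ ⟨l, rfl⟩
    exact ht.2 l
  · rw [Submodule.span_le]
    rintro _ ⟨i, rfl⟩
    exact hν.2 i

/-- The given tangent and normal vectors of a subsimplex form a basis of `ℝⁿ`. -/
noncomputable def frame {s : Finset (Fin (n + 1))} {ℓ : ℕ} (hℓ : ℓ ≤ n) {t : Fin ℓ → E n}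
    {ν : Fin (n - ℓ) → E n} (ht : LinearIndependent ℝ t ∧ ∀ l, t l ∈ tangents K s)
    (hν : LinearIndependent ℝ ν ∧ ∀ i, ν i ∈ normals K s) :
    Module.Basis (Fin ℓ ⊕ Fin (n - ℓ)) ℝ (E n) :=
  Module.Basis.mk (linearIndependent_frame K ht hν) (by
    refine ((linearIndependent_frame K ht hν).span_eq_top_of_card_eq_finrank' ?_).ge
    simp only [Fintype.card_sum, Fintype.card_fin, finrank_euclideanSpace]
    omega)

theorem frame_apply {s : Finset (Fin (n + 1))} {ℓ : ℕ} (hℓ : ℓ ≤ n) {t : Fin ℓ → E n}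
    {ν : Fin (n - ℓ) → E n} (ht : LinearIndependent ℝ t ∧ ∀ l, t l ∈ tangents K s)
    (hν : LinearIndependent ℝ ν ∧ ∀ i, ν i ∈ normals K s) (x : Fin ℓ ⊕ Fin (n - ℓ)) :
    frame K hℓ ht hν x = Sum.elim t ν x :=
  Module.Basis.mk_apply _ _ x

/-- The given normal vectors span all normals, because a tangential normal vector is zero. -/
theorem normals_le_span {s : Finset (Fin (n + 1))} {ℓ : ℕ} (hℓ : ℓ ≤ n) {t : Fin ℓ → E n}
    {ν : Fin (n - ℓ) → E n} (ht : LinearIndependent ℝ t ∧ ∀ l, t l ∈ tangents K s)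
    (hν : LinearIndependent ℝ ν ∧ ∀ i, ν i ∈ normals K s) :
    normals K s ≤ Submodule.span ℝ (Set.range ν) := by
  intro w hw
  have h := (frame K hℓ ht hν).sum_repr w
  simp only [frame_apply, Fintype.sum_sum_type, Sum.elim_inl, Sum.elim_inr] at h
  set c := (frame K hℓ ht hν).repr w
  have h1 : ∑ l, c (Sum.inl l) • t l = w - ∑ i, c (Sum.inr i) • ν i := by
    rw [← h, add_sub_cancel_right]
  have h2 : ∑ l, c (Sum.inl l) • t l ∈ tangents K s :=
    Submodule.sum_mem _ fun l _ => Submodule.smul_mem _ _ (ht.2 l)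
  have h3 : ∑ l, c (Sum.inl l) • t l ∈ normals K s := by
    rw [h1]
    exact sub_mem hw (Submodule.sum_mem _ fun i _ => Submodule.smul_mem _ _ (hν.2 i))
  have h4 := Submodule.disjoint_def.1 (disjoint_tangents_normals K s) _ h2 h3
  rw [← h, h4, zero_add]
  exact Submodule.sum_mem _ fun i _ => Submodule.smul_mem _ _ (Submodule.subset_span ⟨i, rfl⟩)

/-- The components of degrees of freedom on a subsimplex as polynomials. -/
noncomputable def compPoly {ℓ : ℕ} (t : Fin ℓ → E n) (ν : Fin (n - ℓ) → E n) :
    Comp n ℓ → MatField n →ₗ[ℝ] Poly n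
  | Sum.inl a => pairing (t a.1).ofLp (ν a.2).ofLp
  | Sum.inr a => pairing (ν a.1.1).ofLp (ν a.1.2).ofLp

theorem component_eq {ℓ : ℕ} (t : Fin ℓ → E n) (ν : Fin (n - ℓ) → E n) (τ : MatField n) (x : E n)
    (α : Comp n ℓ) : component t ν τ x α = pval (compPoly t ν α τ) x := by
  rcases α with a | a
  · exact (pval_pairing _ _ τ x).symm
  · exact (pval_pairing _ _ τ x).symm

theorem totalDegree_compPoly_le {m ℓ : ℕ} (t : Fin ℓ → E n) (ν : Fin (n - ℓ) → E n)
    {τ : MatField n} (hτ : τ ∈ PSym n m) (α : Comp n ℓ) :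
    (compPoly t ν α τ).totalDegree ≤ m := by
  rcases α with a | a
  · exact totalDegree_pairing_le hτ _ _
  · exact totalDegree_pairing_le hτ _ _

theorem compPoly_eq_zero_of_normal {s : Finset (Fin (n + 1))} {ℓ : ℕ} {t : Fin ℓ → E n}
    {ν : Fin (n - ℓ) → E n} (hν : ∀ i, ν i ∈ normals K s) {τ : MatField n} {x : E n}
    (h : ∀ w ∈ normals K s, (mval τ x).mulVec w.ofLp = 0) (α : Comp n ℓ) :
    pval (compPoly t ν α τ) x = 0 := by
  rcases α with a | a
  · exact (pval_pairing _ _ τ x).trans (by rw [h _ (hν _), dotProduct_zero])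
  · exact (pval_pairing _ _ τ x).trans (by rw [h _ (hν _), dotProduct_zero])

theorem normal_of_compPoly_eq_zero {s : Finset (Fin (n + 1))} {ℓ : ℕ} (hℓ : ℓ ≤ n)
    {t : Fin ℓ → E n} {ν : Fin (n - ℓ) → E n}
    (ht : LinearIndependent ℝ t ∧ ∀ l, t l ∈ tangents K s)
    (hν : LinearIndependent ℝ ν ∧ ∀ i, ν i ∈ normals K s) {τ : MatField n} (hτ : τ.IsSymm)
    {x : E n} (h : ∀ α : Comp n ℓ, pval (compPoly t ν α τ) x = 0) {w : E n}
    (hw : w ∈ normals K s) : (mval τ x).mulVec w.ofLp = 0 := by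
  have h1 : ∀ i y, pval (pairing (frame K hℓ ht hν y).ofLp (ν i).ofLp τ) x = 0 := by
    rintro i (l | j)
    · rw [frame_apply]
      exact h (Sum.inl (l, i))
    · rw [frame_apply]
      rcases le_total j i with hji | hij
      · exact h (Sum.inr ⟨(j, i), hji⟩)
      · rw [pairing_comm hτ]
        exact h (Sum.inr ⟨(i, j), hij⟩)
  have h2 : ∀ i (u : E n), inner ℝ u (WithLp.toLp 2 ((mval τ x).mulVec (ν i).ofLp)) = 0 := by
    intro i u
    rw [← (frame K hℓ ht hν).sum_repr u, sum_inner]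
    refine Finset.sum_eq_zero fun y _ => ?_
    rw [inner_smul_left, inner_eq_dotProduct, ← pval_pairing, h1, mul_zero]
  have h3 : ∀ i, (mval τ x).mulVec (ν i).ofLp = 0 := fun i => by
    have := inner_self_eq_zero.1 (h2 i (WithLp.toLp 2 ((mval τ x).mulVec (ν i).ofLp)))
    exact congrArg WithLp.ofLp this
  have hw' := normals_le_span K hℓ ht hν hw
  clear hw
  induction hw' using Submodule.span_induction with
  | mem w hw => obtain ⟨i, rfl⟩ := hw; exact h3 i
  | zero => exact Matrix.mulVec_zero _
  | add u v _ _ hu hv => rw [WithLp.ofLp_add, Matrix.mulVec_add, hu, hv, add_zero]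
  | smul c u _ hu => rw [WithLp.ofLp_smul, Matrix.mulVec_smul, hu, smul_zero]

/-- There is a constant symmetric matrix with prescribed components. -/
theorem exists_symm_components {s : Finset (Fin (n + 1))} {ℓ : ℕ} (hℓ : ℓ ≤ n)
    {t : Fin ℓ → E n} {ν : Fin (n - ℓ) → E n}
    (ht : LinearIndependent ℝ t ∧ ∀ l, t l ∈ tangents K s)
    (hν : LinearIndependent ℝ ν ∧ ∀ i, ν i ∈ normals K s) (c : Comp n ℓ → ℝ) :
    ∃ S : Matrix (Fin n) (Fin n) ℝ, S.IsSymm ∧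
      (∀ l i, dotProduct (t l).ofLp (S.mulVec (ν i).ofLp) = c (Sum.inl (l, i))) ∧
      ∀ p : {p : Fin (n - ℓ) × Fin (n - ℓ) // p.1 ≤ p.2},
        dotProduct (ν p.1.1).ofLp (S.mulVec (ν p.1.2).ofLp) = c (Sum.inr p) := by
  -- the rows of `D` are the dual basis of the frame, and `N` is the matrix of the form in the frame
  let f := frame K hℓ ht hν
  let D : Matrix (Fin ℓ ⊕ Fin (n - ℓ)) (Fin n) ℝ :=
    Matrix.of fun x a => f.repr (EuclideanSpace.single a 1) x
  have hD : ∀ w : E n, D.mulVec w.ofLp = f.repr w := fun w => by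
    funext x
    conv_rhs => rw [← (EuclideanSpace.basisFun (Fin n) ℝ).sum_repr w]
    simp [D, Matrix.mulVec, dotProduct, mul_comm]
  let N : Matrix (Fin ℓ ⊕ Fin (n - ℓ)) (Fin ℓ ⊕ Fin (n - ℓ)) ℝ :=
    Matrix.fromBlocks 0 (Matrix.of fun l i => c (Sum.inl (l, i)))
      (Matrix.of fun i l => c (Sum.inl (l, i)))
      (Matrix.of fun i j => c (Sum.inr ⟨(min i j, max i j), min_le_max⟩))
  have hN : N.IsSymm := by
    refine Matrix.IsSymm.fromBlocks Matrix.isSymm_zero rfl ?_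
    refine Matrix.IsSymm.ext fun i j => ?_
    simp only [Matrix.of_apply, min_comm, max_comm]
  have key : ∀ x y, dotProduct (f x).ofLp ((D.transpose * N * D).mulVec (f y).ofLp) = N x y := by
    intro x y
    rw [← Matrix.mulVec_mulVec, hD, ← Matrix.mulVec_mulVec, Matrix.dotProduct_mulVec,
      Matrix.vecMul_transpose, hD, f.repr_self, f.repr_self]
    simp [Finsupp.single_eq_pi_single]
  refine ⟨D.transpose * N * D, ?_, fun l i => ?_, fun p => ?_⟩
  · rw [Matrix.IsSymm, Matrix.transpose_mul, Matrix.transpose_mul, Matrix.transpose_transpose,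
      hN.eq, Matrix.mul_assoc]
  · have := key (Sum.inl l) (Sum.inr i)
    simp only [f, frame_apply, Sum.elim_inl, Sum.elim_inr] at this
    exact this
  · have := key (Sum.inr p.1.1) (Sum.inr p.1.2)
    simp only [f, frame_apply, Sum.elim_inr] at this
    refine this.trans ?_
    simp only [N, Matrix.fromBlocks_apply₂₂, Matrix.of_apply, min_eq_left p.2, max_eq_right p.2]

/-! ### Moments on subsimplices -/

/-- A polynomial with given restriction to a subsimplex. -/
noncomputable def lift {s : Finset (Fin (n + 1))} (hs : s.Nonempty) (r : ℕ) :
    PolyOn (faceSet K s) r →ₗ[ℝ] Poly n :=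
  (bern K).toLinearMap ∘ₗ (bernForms s r).subtype ∘ₗ (bernEquiv K hs r).symm.toLinearMap

theorem pval_lift {s : Finset (Fin (n + 1))} (hs : s.Nonempty) {r : ℕ}
    (q : PolyOn (faceSet K s) r) (x : faceSet K s) : pval (lift K hs r q) x = q.1 x := by
  conv_rhs => rw [← (bernEquiv K hs r).apply_symm_apply q]
  rfl

theorem totalDegree_lift_le {s : Finset (Fin (n + 1))} (hs : s.Nonempty) {r : ℕ}
    (q : PolyOn (faceSet K s) r) : (lift K hs r q).totalDegree ≤ r :=
  totalDegree_bern_le K ((bernEquiv K hs r).symm q).2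

/-- The moments of a polynomial over a subsimplex. -/
noncomputable def moments {s : Finset (Fin (n + 1))} {ℓ : ℕ} (hs : s.card = ℓ + 1) (r : ℕ)
    (p : Poly n) : Module.Dual ℝ (PolyOn (faceSet K s) r) :=
  meanPoly K hs ∘ₗ LinearMap.mulLeft ℝ p ∘ₗ lift K (Finset.card_pos.1 (by omega)) r

theorem mean_eq_moments {s : Finset (Fin (n + 1))} {ℓ : ℕ} (hs : s.card = ℓ + 1) {r : ℕ}
    {p : Poly n} {g : faceSet K s → ℝ} (hg : ∀ x : faceSet K s, g x = pval p x)
    (q : PolyOn (faceSet K s) r) :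
    mean (faceSet K s) ℓ (fun x => g x * q.1 x) = moments K hs r p q := by
  have : (fun x => g x * q.1 x) =
      fun x : faceSet K s => pval (p * lift K (Finset.card_pos.1 (by omega)) r q) x := by
    funext x
    rw [pval_mul, pval_lift, hg]
  rw [this]
  rfl

theorem moments_congr {s : Finset (Fin (n + 1))} {ℓ : ℕ} (hs : s.card = ℓ + 1) {r : ℕ}
    {p p' : Poly n} (h : ∀ x ∈ faceSet K s, pval p x = pval p' x) :
    moments K hs r p = moments K hs r p' := by
  ext q
  refine meanPoly_congr K hs fun x hx => ?_
  simp only [LinearMap.comp_apply, LinearMap.mulLeft_apply, pval_mul, h x hx]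

theorem moments_add {s : Finset (Fin (n + 1))} {ℓ : ℕ} (hs : s.card = ℓ + 1) {r : ℕ}
    (p p' : Poly n) : moments K hs r (p + p') = moments K hs r p + moments K hs r p' := by
  ext q
  simp [moments, add_mul]

/-- A multiple `b q` of the bubble function of a subsimplex is determined there by its moments
against the polynomials of the degree of `q`: test with `q` itself. -/
theorem eq_zero_of_moments_bub_eq_zero {s : Finset (Fin (n + 1))} {ℓ : ℕ} (hs : s.card = ℓ + 1)
    {r : ℕ} {q : Poly n} (hq : q.totalDegree ≤ r) (h : moments K hs r (bub K s * q) = 0) {x : E n}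
    (hx : x ∈ faceSet K s) : pval (bub K s * q) x = 0 := by
  let q' : PolyOn (faceSet K s) r := ⟨fun x => pval q x, q, hq, fun _ => rfl⟩
  have h1 := LinearMap.congr_fun h q'
  rw [← mean_eq_moments K hs (g := fun x => pval (bub K s * q) x) (fun _ => rfl)] at h1
  have h2 : meanPoly K hs (bub K s * q * q) = 0 := by
    simp only [LinearMap.zero_apply] at h1
    rw [← h1]
    simp only [q', ← pval_mul]
    rfl
  have h3 := eq_zero_of_meanPoly_eq_zero K hs (fun y hy => by
    rw [mul_assoc, pval_mul]
    exact mul_nonneg (bub_nonneg K hy) (pval_mul_self_nonneg q y)) h2 hx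
  rw [← mul_self_eq_zero, ← pval_mul, show bub K s * q * (bub K s * q) =
    bub K s * (bub K s * q * q) by ring, pval_mul, h3, mul_zero]

theorem exists_moments_bub_eq {s : Finset (Fin (n + 1))} {ℓ : ℕ} (hs : s.card = ℓ + 1) {r : ℕ}
    (φ : Module.Dual ℝ (PolyOn (faceSet K s) r)) :
    ∃ q : Poly n, q.totalDegree ≤ r ∧ moments K hs r (bub K s * q) = φ := by
  have hne : s.Nonempty := Finset.card_pos.1 (by omega)
  have := finiteDimensional_polyOn K hne r
  let B : PolyOn (faceSet K s) r →ₗ[ℝ] PolyOn (faceSet K s) r →ₗ[ℝ] ℝ :=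
    { toFun := fun q => moments K hs r (bub K s * lift K hne r q)
      map_add' := fun p q => by rw [map_add, mul_add, moments_add]
      map_smul' := fun c q => by
        ext q'
        simp [moments, mul_assoc] }
  obtain ⟨q, hq⟩ := exists_represents B (fun q hq => by
    have h1 : meanPoly K hs (bub K s * lift K hne r q * lift K hne r q) = 0 := hq
    have h2 : ∀ x ∈ faceSet K s, pval (bub K s * (lift K hne r q * lift K hne r q)) x = 0 := by
      intro x hx
      rw [← mul_assoc]
      refine eq_zero_of_meanPoly_eq_zero K hs (fun y hy => ?_) h1 hx
      rw [mul_assoc, pval_mul]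
      exact mul_nonneg (bub_nonneg K hy) (pval_mul_self_nonneg _ y)
    ext x
    have h3 := eq_zero_of_bub_mul_eq_zero K hne h2 x.2
    rw [pval_mul, mul_self_eq_zero, pval_lift] at h3
    exact h3) φ
  exact ⟨lift K hne r q, totalDegree_lift_le K hne q, hq⟩

/-! ### Unisolvence of the moments on the boundary -/

/-- A symmetric field whose boundary moments vanish annihilates the normals of each proper
subsimplex there. By induction over the subsimplices, its components on one of them vanish on the
boundary of the latter, so they are multiples of the bubble function. -/
theorem mulVec_eq_zero_of_moments {m : ℕ} (hm : 0 < m) {d : Fin n → ℕ}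
    (hd : ∀ ℓ : Fin n, d ℓ + (ℓ + 1) = m) {τ : MatField n} (hτ : τ ∈ PSym n m)
    (t : ∀ ℓ : Fin n, Sub n ℓ → Fin ℓ → E n)
    (ν : ∀ ℓ : Fin n, Sub n ℓ → Fin (n - ℓ) → E n)
    (ht : ∀ ℓ s, LinearIndependent ℝ (t ℓ s) ∧ ∀ l, t ℓ s l ∈ tangents K s)
    (hν : ∀ ℓ s, LinearIndependent ℝ (ν ℓ s) ∧ ∀ i, ν ℓ s i ∈ normals K s)
    (h : ∀ (ℓ : Fin n) (s : Sub n ℓ) (α : Comp n ℓ),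
      moments K s.2 (d ℓ) (compPoly (t ℓ s) (ν ℓ s) α τ) = 0)
    (s : Finset (Fin (n + 1))) (hs : s ≠ Finset.univ) :
    ∀ x ∈ faceSet K s, ∀ w ∈ normals K s, (mval τ x).mulVec w.ofLp = 0 := by
  induction s using Finset.strongInduction with
  | H s ih =>
    intro x hx w hw
    rcases s.eq_empty_or_nonempty with rfl | hne
    · simp [faceSet] at hx
    have hcard : s.card < n + 1 := by
      have := (Finset.card_lt_iff_ne_univ s).2 hs
      simpa using this
    have hpos := hne.card_pos
    -- `s` spans a subsimplex of dimension `s.card - 1`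
    let ℓ : Fin n := ⟨s.card - 1, by omega⟩
    let s' : Sub n ℓ := ⟨s, by simp only [ℓ]; omega⟩
    refine normal_of_compPoly_eq_zero K ℓ.2.le (ht ℓ s') (hν ℓ s') (mem_PSym.1 hτ).1
      (fun α => ?_) hw
    obtain ⟨q, hq, hqe⟩ := exists_eq_bub_mul K hm (s := s) (f := s)
      (totalDegree_compPoly_le (t ℓ s') (ν ℓ s') hτ α) (fun i hi y hy => by
        refine compPoly_eq_zero_of_normal K (s := s.erase i)
          (fun j => normals_anti K (Finset.erase_subset i s) ((hν ℓ s').2 j)) ?_ α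
        refine ih _ (Finset.erase_ssubset hi) (fun e => ?_) y hy
        have := Finset.mem_univ i
        rw [← e] at this
        exact Finset.notMem_erase i s this)
    rw [hqe x hx]
    have hcard' : s.card = ℓ + 1 := s'.2
    rw [hcard', ← hd ℓ, Nat.add_sub_cancel] at hq
    refine eq_zero_of_moments_bub_eq_zero K s'.2 hq ?_ hx
    rw [← h ℓ s' α]
    exact moments_congr K s'.2 fun y hy => (hqe y hy).symm

/-- Prescribed moments on one subsimplex are attained by a symmetric field that vanishes on the
subsimplices not containing it. -/
theorem exists_bub_field {m ℓ r : ℕ} (hℓ : ℓ ≤ n) (hr : r + (ℓ + 1) = m) {s : Finset (Fin (n + 1))}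
    (hs : s.card = ℓ + 1) {t : Fin ℓ → E n} {ν : Fin (n - ℓ) → E n}
    (ht : LinearIndependent ℝ t ∧ ∀ l, t l ∈ tangents K s)
    (hν : LinearIndependent ℝ ν ∧ ∀ i, ν i ∈ normals K s)
    (a : Comp n ℓ → Module.Dual ℝ (PolyOn (faceSet K s) r)) :
    ∃ σ ∈ PSym n m, (∀ α, moments K hs r (compPoly t ν α σ) = a α) ∧
      ∀ s', ¬ s ⊆ s' → ∀ x ∈ faceSet K s', mval σ x = 0 := by
  choose q hq hqa using fun α => exists_moments_bub_eq K hs (a α)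
  choose S hS hS1 hS2 using fun α : Comp n ℓ =>
    exists_symm_components K hℓ ht hν (fun β => if β = α then 1 else 0)
  let σ : MatField n := Matrix.of fun i j =>
    bub K s * ∑ α, MvPolynomial.C (S α i j) * q α
  have hval : ∀ x, mval σ x = pval (bub K s) x • ∑ α, pval (q α) x • S α := by
    intro x
    ext i j
    simp [mval, σ, Matrix.sum_apply, mul_comm]
  have hpair : ∀ (u w : Fin n → ℝ) x, pval (pairing u w σ) x =
      pval (bub K s) x * ∑ α, pval (q α) x * dotProduct u ((S α).mulVec w) := by
    intro u w x
    rw [pval_pairing, hval, Matrix.smul_mulVec, dotProduct_smul, Matrix.sum_mulVec,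
      dotProduct_sum, smul_eq_mul]
    simp only [Matrix.smul_mulVec, dotProduct_smul, smul_eq_mul]
  have hcomp : ∀ α, compPoly t ν α σ = bub K s * q α := by
    intro α
    refine poly_ext fun x => ?_
    rcases α with α | α
    · refine (hpair _ _ x).trans ?_
      simp only [hS1, mul_ite, mul_one, mul_zero, Prod.mk.eta, Finset.sum_ite_eq, Finset.mem_univ,
        if_true, pval_mul]
    · refine (hpair _ _ x).trans ?_
      simp only [hS2, mul_ite, mul_one, mul_zero, Finset.sum_ite_eq, Finset.mem_univ,
        if_true, pval_mul]
  refine ⟨σ, ?_, fun α => by rw [hcomp, hqa], fun s' hs' x hx => ?_⟩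
  · rw [mem_PSym]
    refine ⟨Matrix.IsSymm.ext fun i j => ?_, fun i j => ?_⟩
    · simp only [σ, Matrix.of_apply, fun α => (hS α).apply i j]
    · refine (MvPolynomial.totalDegree_mul _ _).trans ?_
      have h1 : (bub K s).totalDegree ≤ ℓ + 1 := by
        refine (MvPolynomial.totalDegree_finsetProd _ _).trans ?_
        refine (Finset.sum_le_sum fun i _ => totalDegree_lam_le K i).trans ?_
        simp [hs]
      have h2 : (∑ α, MvPolynomial.C (S α i j) * q α).totalDegree ≤ r := by
        refine MvPolynomial.totalDegree_finsetSum_le fun α _ => ?_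
        refine (MvPolynomial.totalDegree_mul _ _).trans ?_
        rw [MvPolynomial.totalDegree_C, zero_add]
        exact hq α
      omega
  · obtain ⟨i, hi, his⟩ := Finset.not_subset.1 hs'
    rw [hval, bub, pval_prod, Finset.prod_eq_zero hi, zero_smul]
    rw [pval_lam]
    exact ((mem_faceSet_iff K s' x).1 hx).2 i his

theorem pval_compPoly_eq_zero {ℓ : ℕ} (t : Fin ℓ → E n) (ν : Fin (n - ℓ) → E n) {σ : MatField n}
    {x : E n} (h : mval σ x = 0) (α : Comp n ℓ) : pval (compPoly t ν α σ) x = 0 := by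
  rw [← component_eq]
  rcases α with a | a <;> simp [component, h]

/-- Boundary moments can be prescribed: they are adjusted on one subsimplex at a time, in the order of
increasing dimension, by fields that vanish on the subsimplices treated before. -/
theorem exists_moments_eq {m : ℕ} {d : Fin n → ℕ} (hd : ∀ ℓ : Fin n, d ℓ + (ℓ + 1) = m)
    (t : ∀ ℓ : Fin n, Sub n ℓ → Fin ℓ → E n)
    (ν : ∀ ℓ : Fin n, Sub n ℓ → Fin (n - ℓ) → E n)
    (ht : ∀ ℓ s, LinearIndependent ℝ (t ℓ s) ∧ ∀ l, t ℓ s l ∈ tangents K s)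
    (hν : ∀ ℓ s, LinearIndependent ℝ (ν ℓ s) ∧ ∀ i, ν ℓ s i ∈ normals K s)
    (a : ∀ (ℓ : Fin n) (s : Sub n ℓ), Comp n ℓ →
      Module.Dual ℝ (PolyOn (faceSet K s) (d ℓ))) :
    ∃ τ ∈ PSym n m, ∀ (ℓ : Fin n) (s : Sub n ℓ) (α : Comp n ℓ),
      moments K s.2 (d ℓ) (compPoly (t ℓ s) (ν ℓ s) α τ) = a ℓ s α := by
  have claim : ∀ r ≤ n, ∃ τ ∈ PSym n m, ∀ (ℓ : Fin n) (s : Sub n ℓ) (α : Comp n ℓ), (ℓ : ℕ) < r →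
      moments K s.2 (d ℓ) (compPoly (t ℓ s) (ν ℓ s) α τ) = a ℓ s α := by
    intro r
    induction r with
    | zero => exact fun _ => ⟨0, Submodule.zero_mem _, fun _ _ _ h => absurd h (Nat.not_lt_zero _)⟩
    | succ r ih =>
      intro hr
      obtain ⟨τ, hτ, hτa⟩ := ih (by omega)
      let ℓ₀ : Fin n := ⟨r, hr⟩
      choose σ hσ hσa hσ0 using fun s : Sub n ℓ₀ =>
        exists_bub_field K ℓ₀.2.le (hd ℓ₀) s.2 (ht ℓ₀ s) (hν ℓ₀ s)
          (fun α => a ℓ₀ s α -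
            moments K s.2 (d ℓ₀) (compPoly (t ℓ₀ s) (ν ℓ₀ s) α τ))
      refine ⟨τ + ∑ s, σ s, add_mem hτ (Submodule.sum_mem _ fun s _ => hσ s), ?_⟩
      intro ℓ s α hℓ
      rcases Nat.lt_succ_iff_lt_or_eq.1 hℓ with h | h
      · rw [← hτa ℓ s α h]
        refine moments_congr K s.2 fun x hx => ?_
        rw [map_add, pval_add, map_sum, pval_sum, Finset.sum_eq_zero, add_zero]
        intro s' _
        refine pval_compPoly_eq_zero _ _ (hσ0 s' s (fun hss => ?_) x hx) α
        have h1 := Finset.card_le_card hss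
        have h2 : s.1.card = ℓ + 1 := s.2
        have h3 : s'.1.card = r + 1 := s'.2
        omega
      · obtain rfl : ℓ = ℓ₀ := Fin.ext h
        have h1 : moments K s.2 (d ℓ₀) (compPoly (t ℓ₀ s) (ν ℓ₀ s) α (τ + ∑ s, σ s)) =
            moments K s.2 (d ℓ₀) (compPoly (t ℓ₀ s) (ν ℓ₀ s) α τ +
              compPoly (t ℓ₀ s) (ν ℓ₀ s) α (σ s)) := by
          refine moments_congr K s.2 fun x hx => ?_
          rw [map_add, pval_add, pval_add, map_sum, pval_sum,
            Finset.sum_eq_single s _ (fun h => absurd (Finset.mem_univ s) h)]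
          intro s' _ hne
          refine pval_compPoly_eq_zero _ _ (hσ0 s' s (fun hss => hne ?_) x hx) α
          exact Subtype.ext (Finset.eq_of_subset_of_card_le hss (s.2.trans s'.2.symm).le)
        rw [h1, moments_add, hσa, add_sub_cancel]
  obtain ⟨τ, hτ, hτa⟩ := claim n le_rfl
  exact ⟨τ, hτ, fun ℓ s α => hτa ℓ s α ℓ.2⟩

/-! ### Dimensions -/

/-- Vector fields of bounded degree as families of polynomials of bounded degree. -/
noncomputable def PVecEquiv (n m : ℕ) :
    PVec n m ≃ₗ[ℝ] (Fin n → MvPolynomial.restrictTotalDegree (Fin n) ℝ m) where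
  toFun v i := ⟨v.1 i, v.2 i trivial⟩
  invFun v := ⟨fun i => (v i).1, fun i _ => (v i).2⟩
  map_add' _ _ := rfl
  map_smul' _ _ := rfl
  left_inv _ := rfl
  right_inv _ := rfl

instance finiteDimensional_PVec (m : ℕ) : FiniteDimensional ℝ (PVec n m) :=
  Module.Finite.equiv (PVecEquiv n m).symm

theorem finrank_PVec (K : Affine.Simplex ℝ (E n) n) (m : ℕ) :
    Module.finrank ℝ (PVec n m) = n * (m + n).choose n := by
  rw [(PVecEquiv n m).finrank_eq, Module.finrank_pi_fintype]
  simp [finrank_restrictTotalDegree K]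

theorem card_le_pairs (r : ℕ) :
    Fintype.card {p : Fin r × Fin r // p.1 ≤ p.2} = (r + 1).choose 2 := by
  let f : {p : Fin r × Fin r // p.1 ≤ p.2} ≃ Σ j : Fin r, Fin (j + 1) :=
    { toFun := fun p => ⟨p.1.2, ⟨p.1.1, Nat.lt_succ_of_le p.2⟩⟩
      invFun := fun a => ⟨(⟨a.2, (Nat.le_of_lt_succ a.2.2).trans_lt a.1.2⟩, a.1),
        Nat.le_of_lt_succ a.2.2⟩
      left_inv := fun _ => rfl
      right_inv := fun _ => rfl }
  rw [Fintype.card_congr f, Fintype.card_sigma]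
  simp only [Fintype.card_fin]
  rw [Fin.sum_univ_eq_sum_range (fun i => i + 1) r, Nat.choose_two_right, ← Finset.sum_range_id,
    Finset.sum_range_succ']
  rfl

theorem finrank_data {s : Finset (Fin (n + 1))} {ℓ r : ℕ} (hs : s.card = ℓ + 1) (hℓ : ℓ ≤ n) :
    Module.finrank ℝ (Comp n ℓ → Module.Dual ℝ (PolyOn (faceSet K s) r)) =
      ((n + 1 - ℓ).choose 2 + ℓ * (n - ℓ)) * (r + ℓ).choose ℓ := by
  have := finiteDimensional_polyOn K (Finset.card_pos.1 (by omega : 0 < s.card)) r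
  rw [Module.finrank_pi_fintype]
  simp only [Subspace.dual_finrank_eq, finrank_polyOn K r ℓ hs, Finset.sum_const,
    Finset.card_univ, Fintype.card_sum, Fintype.card_prod, Fintype.card_fin, card_le_pairs,
    smul_eq_mul]
  rw [add_comm (ℓ * (n - ℓ)), Nat.sub_add_comm hℓ]

/-- Bubble fields with coefficients of degree at most `r`. -/
noncomputable def bubMap (r : ℕ) :
    (Edge n → MvPolynomial.restrictTotalDegree (Fin n) ℝ r) →ₗ[ℝ] MatField n :=
  bubbleField K ∘ₗ LinearMap.pi fun e => (Submodule.subtype _) ∘ₗ LinearMap.proj e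

theorem bubMap_apply {r : ℕ} (q : Edge n → MvPolynomial.restrictTotalDegree (Fin n) ℝ r) :
    bubMap K r q = bubbleField K fun e => (q e).1 := rfl

theorem totalDegree_coe_le {r : ℕ} (q : MvPolynomial.restrictTotalDegree (Fin n) ℝ r) :
    q.1.totalDegree ≤ r :=
  (MvPolynomial.mem_restrictTotalDegree _ _ _).1 q.2

theorem bubMap_injective (r : ℕ) : Function.Injective (bubMap K r) := by
  intro p q h
  have := bubbleField_injective K h
  funext e
  exact Subtype.ext (congrFun this e)

/-- The divergence of bubble fields. -/
noncomputable def divMap (r : ℕ) :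
    (Edge n → MvPolynomial.restrictTotalDegree (Fin n) ℝ r) →ₗ[ℝ] PVec n (r + 1) :=
  (divg ∘ₗ bubMap K r).codRestrict _ fun q =>
    divg_mem_PVec (m := r + 2) (bubbleField_mem_PSym K fun e => totalDegree_coe_le (q e))

/-- The `L²` product on vector fields of bounded degree. -/
noncomputable abbrev formP (m : ℕ) : LinearMap.BilinForm ℝ (PVec n m) := (formV K).restrict _

theorem formP_isSymm (m : ℕ) : (formP K m).IsSymm := ⟨fun u v => formV_comm K u v⟩

theorem formP_definite (m : ℕ) (v : PVec n m) (h : formP K m v v = 0) : v = 0 :=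
  Subtype.ext (eq_zero_of_formV_eq_zero K h)

theorem orthogonal_divMap_iff {r : ℕ} (v : PVec n (r + 1)) :
    symGrad (v : VecField n) = 0 ↔ ∀ q, formP K (r + 1) (divMap K r q) v = 0 := by
  constructor
  · intro h q
    have := formM_bubbleField_symGrad K (fun e => (q e).1) v
    rw [h, map_zero, eq_comm, neg_eq_zero] at this
    exact this
  · intro h
    refine symGrad_eq_zero_of_orthogonal K v.2 fun q hq => ?_
    exact h fun e => ⟨q e, (MvPolynomial.mem_restrictTotalDegree _ _ _).2 (hq e)⟩

/-- The divergences of bubble fields are the fields orthogonal to the rigid motions. -/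
theorem exists_divg_bubMap_eq {r : ℕ} {w : VecField n} (hw : w ∈ PVec n (r + 1))
    (h : ∀ v : VecField n, symGrad v = 0 → formV K v w = 0) :
    ∃ q, divg (bubMap K r q) = w := by
  obtain ⟨q, hq⟩ := mem_range_of_orthogonal (formP K (r + 1)) (formP_isSymm K _)
    (formP_definite K _) (divMap K r) ⟨w, hw⟩
    fun v hv => h v ((orthogonal_divMap_iff K v).2 hv)
  exact ⟨q, congrArg Subtype.val hq⟩

theorem finrank_submoduleOf {V : Type*} [AddCommGroup V] [Module ℝ V] {p q : Submodule ℝ V}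
    (h : p ≤ q) : Module.finrank ℝ (p.comap q.subtype) = Module.finrank ℝ p :=
  (Submodule.comapSubtypeEquivOfLe h).finrank_eq

theorem finrank_range_divMap (r : ℕ) :
    Module.finrank ℝ (LinearMap.range (divMap K r)) + (n + 1).choose 2 =
      n * (r + 1 + n).choose n := by
  have h := finrank_range_add_finrank_orthogonal (formP K (r + 1))
    (formP_definite K _) (divMap K r) ((LinearMap.ker symGrad).comap (PVec n (r + 1)).subtype)
    (fun v => orthogonal_divMap_iff K v)
  rwa [finrank_submoduleOf (ker_symGrad_le_PVec (by omega)), finrank_ker_symGrad,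
    finrank_PVec K] at h

theorem finrank_epsSpace (K : Affine.Simplex ℝ (E n) n) {k : ℕ} (hk : 2 < k) :
    Module.finrank ℝ (epsSpace n k) + (n + 1).choose 2 = n * (n + k - 1).choose n := by
  have h := ((symGrad (n := n)).domRestrict (PVec n (k - 1))).finrank_range_add_finrank_ker
  rw [LinearMap.range_domRestrict, LinearMap.ker_domRestrict, finrank_PVec K,
    finrank_submoduleOf (ker_symGrad_le_PVec (by omega)), finrank_ker_symGrad,
    show k - 1 + n = n + k - 1 by omega] at h
  exact h

/-- `M_k(K)` consists of the divergence-free bubble fields. -/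
theorem MSpace_eq (hn : 1 ≤ n) {k : ℕ} (hk : 2 < k) :
    MSpace K k = (LinearMap.ker (divMap K (k + n - 3))).map (bubMap K (k + n - 3)) := by
  have hr : k + n - 3 + 2 = k + n - 1 := by omega
  ext τ
  constructor
  · rintro ⟨h1, h2, h3⟩
    obtain ⟨h4, -⟩ := (mem_PStar hn (by omega)).1 h1
    rw [← hr] at h4
    obtain ⟨q, hq, rfl⟩ := exists_bubbleField_eq K h4 h3
    exact ⟨fun e => ⟨q e, (MvPolynomial.mem_restrictTotalDegree _ _ _).2 (hq e)⟩,
      Subtype.ext h2, rfl⟩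
  · rintro ⟨q, hq, rfl⟩
    have h2 : divg (bubMap K (k + n - 3) q) = 0 := congrArg Subtype.val hq
    refine ⟨(mem_PStar hn (by omega)).2 ⟨?_, ?_⟩, h2, fun i x hx ν hν =>
      bubbleField_mulVec_eq_zero K _ hx hν⟩
    · rw [← hr]
      exact bubbleField_mem_PSym K fun e => totalDegree_coe_le (q e)
    · rw [h2]
      exact Submodule.zero_mem _

theorem finiteDimensional_MSpace (hn : 1 ≤ n) {k : ℕ} (hk : 2 < k) :
    FiniteDimensional ℝ (MSpace K k) := by
  rw [MSpace_eq K hn hk]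
  infer_instance

theorem finrank_MSpace (hn : 1 ≤ n) {k : ℕ} (hk : 2 < k) :
    Module.finrank ℝ (MSpace K k) + n * (k + 2 * n - 2).choose n =
      (n + 1).choose 2 * (k + 2 * n - 3).choose n + (n + 1).choose 2 := by
  have h1 := (divMap K (k + n - 3)).finrank_range_add_finrank_ker
  have h2 := finrank_range_divMap K (k + n - 3)
  rw [Module.finrank_pi_fintype] at h1
  simp only [finrank_restrictTotalDegree K, Finset.sum_const, Finset.card_univ, card_lt_pairs,
    smul_eq_mul] at h1
  rw [MSpace_eq K hn hk,
    ← (Submodule.equivMapOfInjective _ (bubMap_injective K (k + n - 3)) _).finrank_eq]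
  rw [show k + n - 3 + n = k + 2 * n - 3 by omega] at h1
  rw [show k + n - 3 + 1 + n = k + 2 * n - 2 by omega] at h2
  omega

/-! ### Unisolvence -/

theorem mean_component_eq {ℓ r : ℕ} {s : Finset (Fin (n + 1))} (hs : s.card = ℓ + 1)
    (t : Fin ℓ → E n) (ν : Fin (n - ℓ) → E n) (τ : MatField n) (α : Comp n ℓ)
    (q : PolyOn (faceSet K s) r) :
    mean (faceSet K s) ℓ (fun x => component t ν τ x α * q.1 x) =
      moments K hs r (compPoly t ν α τ) q :=
  mean_eq_moments K hs (g := fun x => component t ν τ x α)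
    (fun x => component_eq t ν τ x α) q

theorem moments_compPoly_bubbleField {ℓ r : ℕ} {s : Finset (Fin (n + 1))} (hs : s.card = ℓ + 1)
    {t : Fin ℓ → E n} {ν : Fin (n - ℓ) → E n} (hν : ∀ i, ν i ∈ normals K s)
    (q : Edge n → Poly n) (τ : MatField n) (α : Comp n ℓ) :
    moments K hs r (compPoly t ν α (τ + bubbleField K q)) =
      moments K hs r (compPoly t ν α τ) := by
  refine moments_congr K hs fun x hx => ?_
  rw [map_add, pval_add, compPoly_eq_zero_of_normal K hν
    (fun w hw => bubbleField_mulVec_eq_zero K q hx hw), add_zero]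

/-- A field in the enriched space whose degrees of freedom all vanish is zero. -/
theorem eq_zero_of_dofs_eq_zero {k : ℕ} (hn : 1 ≤ n) (hk : 2 < k) {τ : MatField n}
    (hτ : τ ∈ PStar n k)
    (t : ∀ ℓ : Fin n, Sub n ℓ → Fin ℓ → E n)
    (ν : ∀ ℓ : Fin n, Sub n ℓ → Fin (n - ℓ) → E n)
    (ht : ∀ ℓ s, LinearIndependent ℝ (t ℓ s) ∧ ∀ l, t ℓ s l ∈ tangents K s)
    (hν : ∀ ℓ s, LinearIndependent ℝ (ν ℓ s) ∧ ∀ i, ν ℓ s i ∈ normals K s)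
    (h1 : ∀ (ℓ : Fin n) (s : Sub n ℓ) (α : Comp n ℓ),
      moments K s.2 (k + n - ℓ - 2) (compPoly (t ℓ s) (ν ℓ s) α τ) = 0)
    (h2 : ∀ v ∈ PVec n (k - 1), formM K τ (symGrad v) = 0)
    (h3 : ∀ θ ∈ MSpace K k, formM K τ θ = 0) : τ = 0 := by
  obtain ⟨h4, h5⟩ := (mem_PStar hn (by omega)).1 hτ
  have h6 := mulVec_eq_zero_of_moments K (by omega) (d := fun ℓ => k + n - ℓ - 2)
    (fun ℓ => by have := ℓ.2; omega) h4 t ν ht hν h1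
  have h7 : ∀ i : Fin (n + 1), ∀ x ∈ faceSet K {i}ᶜ, ∀ ν ∈ normals K {i}ᶜ,
      (mval τ x).mulVec ν.ofLp = 0 := fun i => h6 _ (by simp)
  have h8 : divg τ = 0 := by
    have hr : k + n - 3 + 2 = k + n - 1 := by omega
    rw [← hr] at h4
    obtain ⟨q, -, rfl⟩ := exists_bubbleField_eq K h4 h7
    refine eq_zero_of_formV_eq_zero K ?_
    have := formM_bubbleField_symGrad K q (divg (bubbleField K q))
    rw [h2 _ h5, eq_comm, neg_eq_zero] at this
    exact this
  exact eq_zero_of_formM_eq_zero K (h3 τ ⟨hτ, h8, h7⟩)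

/-- All degrees of freedom can be prescribed. A symmetric field with the given boundary moments is
corrected by a bubble field that brings the divergence into the required finite-dimensional space
and fixes the moments against symmetric gradients, then by a divergence-free bubble field. -/
theorem exists_dofs_eq {k : ℕ} (hn : 1 ≤ n) (hk : 2 < k)
    (t : ∀ ℓ : Fin n, Sub n ℓ → Fin ℓ → E n)
    (ν : ∀ ℓ : Fin n, Sub n ℓ → Fin (n - ℓ) → E n)
    (ht : ∀ ℓ s, LinearIndependent ℝ (t ℓ s) ∧ ∀ l, t ℓ s l ∈ tangents K s)
    (hν : ∀ ℓ s, LinearIndependent ℝ (ν ℓ s) ∧ ∀ i, ν ℓ s i ∈ normals K s)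
    (a : ∀ (ℓ : Fin n) (s : Sub n ℓ), Comp n ℓ →
      Module.Dual ℝ (PolyOn (faceSet K s) (k + n - ℓ - 2)))
    (b : Module.Dual ℝ (epsSpace n k)) (c : Module.Dual ℝ (MSpace K k)) :
    ∃ τ ∈ PStar n k,
      (∀ (ℓ : Fin n) (s : Sub n ℓ) (α : Comp n ℓ),
        moments K s.2 (k + n - ℓ - 2) (compPoly (t ℓ s) (ν ℓ s) α τ) = a ℓ s α) ∧
      (∀ θ : epsSpace n k, formM K τ θ = b θ) ∧ ∀ θ : MSpace K k, formM K τ θ = c θ := by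
  have hr : k + n - 3 + 2 = k + n - 1 := by omega
  obtain ⟨τ₀, hτ₀, hτ₀a⟩ := exists_moments_eq K (m := k + n - 1) (d := fun ℓ => k + n - ℓ - 2)
    (fun ℓ => by have := ℓ.2; omega) t ν ht hν a
  -- `w` is the divergence of the corrected field, dictated by Green's formula; `L` annihilates the
  -- rigid motions up to the term with `div τ₀`, so `w - div τ₀` is orthogonal to them
  let ε : PVec n (k - 1) →ₗ[ℝ] epsSpace n k := symGrad.submoduleMap (PVec n (k - 1))
  let L : Module.Dual ℝ (PVec n (k - 1)) :=
    formV K (divg τ₀) ∘ₗ (PVec n (k - 1)).subtype +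
      formM K τ₀ ∘ₗ (epsSpace n k).subtype ∘ₗ ε - b ∘ₗ ε
  obtain ⟨w, hw⟩ := exists_represents (formP K (k - 1)) (formP_definite K _) L
  have hwL : ∀ v : PVec n (k - 1), formV K w v =
      formV K (divg τ₀) v + formM K τ₀ (symGrad v) - b (ε v) := fun v => LinearMap.congr_fun hw v
  obtain ⟨q₁, hq₁⟩ := exists_divg_bubMap_eq K (r := k + n - 3) (w := w - divg τ₀) (by
      refine sub_mem (PVec_mono (by omega) w.2) ?_
      have := divg_mem_PVec hτ₀
      rwa [show k + n - 1 - 1 = k + n - 3 + 1 by omega] at this) (by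
      intro v hv
      have hvP : v ∈ PVec n (k - 1) := ker_symGrad_le_PVec (by omega) hv
      have h1 := hwL ⟨v, hvP⟩
      have h2 : ε ⟨v, hvP⟩ = 0 := Subtype.ext hv
      rw [h2, hv] at h1
      rw [formV_comm, map_sub, LinearMap.sub_apply, h1]
      simp)
  have hτ₁ : bubMap K (k + n - 3) q₁ ∈ PSym n (k + n - 1) := by
    rw [← hr]
    exact bubbleField_mem_PSym K fun e => totalDegree_coe_le (q₁ e)
  let τ₁ := τ₀ + bubMap K (k + n - 3) q₁
  have hτ₁P : τ₁ ∈ PStar n k := by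
    refine (mem_PStar hn (by omega)).2 ⟨add_mem hτ₀ hτ₁, ?_⟩
    rw [map_add, hq₁, add_sub_cancel]
    exact w.2
  have hτ₁b : ∀ v : PVec n (k - 1), formM K τ₁ (symGrad v) = b (ε v) := by
    intro v
    have h1 : formM K (bubMap K (k + n - 3) q₁) (symGrad v) = -formV K (w - divg τ₀) v := by
      rw [← hq₁]
      exact formM_bubbleField_symGrad K _ _
    rw [map_add, LinearMap.add_apply, h1, map_sub, LinearMap.sub_apply, hwL]
    ring
  have := finiteDimensional_MSpace K hn hk
  obtain ⟨θ, hθ⟩ := exists_represents ((formM K).restrict (MSpace K k))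
    (fun θ h => Subtype.ext (eq_zero_of_formM_eq_zero K h))
    (c - formM K τ₁ ∘ₗ (MSpace K k).subtype)
  have hθc : ∀ μ : MSpace K k, formM K θ μ = c μ - formM K τ₁ μ := fun μ =>
    LinearMap.congr_fun hθ μ
  have hθdiv : divg (θ : MatField n) = 0 := θ.2.2.1
  obtain ⟨q₂, -, hq₂⟩ : (θ : MatField n) ∈
      (LinearMap.ker (divMap K (k + n - 3))).map (bubMap K (k + n - 3)) := by
    rw [← MSpace_eq K hn hk]
    exact θ.2
  refine ⟨τ₁ + θ, add_mem hτ₁P θ.2.1, fun ℓ s α => ?_, ?_, fun μ => ?_⟩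
  · rw [← hq₂, ← hτ₀a ℓ s α]
    exact (moments_compPoly_bubbleField K s.2 (hν ℓ s).2 _ τ₁ α).trans
      (moments_compPoly_bubbleField K s.2 (hν ℓ s).2 _ τ₀ α)
  · rintro ⟨_, v, hv, rfl⟩
    have h1 : formM K (θ : MatField n) (symGrad v) = 0 := by
      have := formM_bubbleField_symGrad K (fun e => (q₂ e).1) v
      rw [← bubMap_apply, hq₂, hθdiv, map_zero, LinearMap.zero_apply, neg_zero] at this
      exact this
    rw [map_add, LinearMap.add_apply, h1, add_zero]
    exact hτ₁b ⟨v, hv⟩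
  · rw [map_add, LinearMap.add_apply, hθc, add_sub_cancel]

theorem cast_factorial_div (r n : ℕ) :
    (((r + n).factorial : ℚ) / (n.factorial * r.factorial)) = (r + n).choose n := by
  rw [Nat.cast_choose ℚ (Nat.le_add_left n r), Nat.add_sub_cancel]

end SymTensorElement

open SymTensorElement in
theorem mainTheorem5 (n k : ℕ) (hn : 1 ≤ n) (hk : 2 < k)
    (K : Affine.Simplex ℝ (E n) n)
    (t : ∀ ℓ : Fin n, Sub n ℓ → Fin ℓ → E n)
    (ν : ∀ ℓ : Fin n, Sub n ℓ → Fin (n - ℓ) → E n)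
    (ht : ∀ ℓ s, LinearIndependent ℝ (t ℓ s) ∧ ∀ l, t ℓ s l ∈ tangents K s)
    (hν : ∀ ℓ s, LinearIndependent ℝ (ν ℓ s) ∧ ∀ i, ν ℓ s i ∈ normals K s) :
    (∀ (a : ∀ (ℓ : Fin n) (s : Sub n ℓ), Comp n ℓ →
          Module.Dual ℝ (PolyOn (faceSet K s) (k + n - ℓ - 2)))
        (b : Module.Dual ℝ (epsSpace n k))
        (c : Module.Dual ℝ (MSpace K k)),
      ∃! τ : MatField n, τ ∈ PStar n k ∧
        (∀ (ℓ : Fin n) (s : Sub n ℓ) (α : Comp n ℓ)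
            (q : PolyOn (faceSet K s) (k + n - ℓ - 2)),
          mean (faceSet K s) ℓ (fun x => component (t ℓ s) (ν ℓ s) τ x α * q.1 x)
            = a ℓ s α q) ∧
        (∀ θ : epsSpace n k, inner2 K τ θ = b θ) ∧
        (∀ θ : MSpace K k, inner2 K τ θ = c θ)) ∧
    (∀ (ℓ : Fin n) (s : Sub n ℓ),
      Module.finrank ℝ (Comp n ℓ → Module.Dual ℝ (PolyOn (faceSet K s) (k + n - ℓ - 2)))
          = ((n + 1 - ℓ).choose 2 + ℓ * (n - ℓ)) * (k + n - 2).choose ℓ ∧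
      (((n + 1 - ℓ).choose 2 + ℓ * (n - ℓ)) * (k + n - 2).choose ℓ : ℚ)
          = ((n : ℚ) - (ℓ : ℕ)) * ((n : ℚ) + (ℓ : ℕ) + 1) / 2 * (k + n - 2).choose ℓ) ∧
    ((Module.finrank ℝ (epsSpace n k) : ℚ)
        = n * (n + k - 1).choose n - n * (n + 1) / 2) ∧
    ((Module.finrank ℝ (MSpace K k) : ℚ)
        = (k + 2 * n - 3).factorial / (n.factorial * (k + n - 3).factorial) * (n * (n + 1) / 2)
          + n * (n + 1) / 2
          - n * ((k + 2 * n - 2).factorial / (n.factorial * (k + n - 2).factorial))) := by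
  have hchoose : (((n + 1).choose 2 : ℕ) : ℚ) = n * (n + 1) / 2 := by
    rw [Nat.cast_choose_two]
    push_cast
    ring
  refine ⟨fun a b c => ?_, fun ℓ s => ⟨?_, ?_⟩, ?_, ?_⟩
  · simp only [inner2_eq, ← formM_apply]
    obtain ⟨τ, hτ, ha, hb, hc⟩ := exists_dofs_eq K hn hk t ν ht hν a b c
    refine ⟨τ, ⟨hτ, fun ℓ s α q => by rw [← ha, mean_component_eq K s.2], hb, hc⟩, ?_⟩
    rintro σ ⟨hσ, ha', hb', hc'⟩
    rw [← sub_eq_zero]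
    refine eq_zero_of_dofs_eq_zero K hn hk (sub_mem hσ hτ) t ν ht hν (fun ℓ s α => ?_)
      (fun v hv => ?_) (fun θ hθ => ?_)
    · have h1 : moments K s.2 (k + n - ℓ - 2) (compPoly (t ℓ s) (ν ℓ s) α σ) = a ℓ s α :=
        LinearMap.ext fun q => by rw [← ha', mean_component_eq K s.2]
      have h2 := moments_add K s.2 (r := k + n - ℓ - 2)
        (compPoly (t ℓ s) (ν ℓ s) α (σ - τ)) (compPoly (t ℓ s) (ν ℓ s) α τ)
      rw [← map_add, sub_add_cancel, h1, ha ℓ s α] at h2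
      exact right_eq_add.1 h2
    · have h1 := hb ⟨symGrad v, v, hv, rfl⟩
      have h2 := hb' ⟨symGrad v, v, hv, rfl⟩
      rw [map_sub, LinearMap.sub_apply, sub_eq_zero]
      exact h2.trans h1.symm
    · have h1 := hc ⟨θ, hθ⟩
      have h2 := hc' ⟨θ, hθ⟩
      rw [map_sub, LinearMap.sub_apply, sub_eq_zero]
      exact h2.trans h1.symm
  · rw [finrank_data K s.2 ℓ.2.le, show k + n - ℓ - 2 + ℓ = k + n - 2 by have := ℓ.2; omega]
  · have h : ((n + 1 - ℓ : ℕ) : ℚ) = n + 1 - (ℓ : ℕ) := by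
      rw [Nat.cast_sub (by have := ℓ.2; omega)]
      push_cast
      rfl
    rw [Nat.cast_choose_two, h]
    ring
  · have h : ((Module.finrank ℝ (epsSpace n k) : ℚ)) + ((n + 1).choose 2 : ℕ) =
        n * (n + k - 1).choose n := by
      exact_mod_cast finrank_epsSpace K hk
    rw [hchoose] at h
    linarith
  · have h : ((Module.finrank ℝ (MSpace K k) : ℚ)) + n * (k + 2 * n - 2).choose n =
        ((n + 1).choose 2 : ℕ) * (k + 2 * n - 3).choose n + ((n + 1).choose 2 : ℕ) := by
      exact_mod_cast finrank_MSpace K hn hk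
    have h1 := cast_factorial_div (k + n - 3) n
    have h2 := cast_factorial_div (k + n - 2) n
    rw [show k + n - 3 + n = k + 2 * n - 3 by omega] at h1
    rw [show k + n - 2 + n = k + 2 * n - 2 by omega] at h2
    rw [hchoose] at h
    rw [h1, h2]
    linarith
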